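/- Let $(X,\delta)$ be a metric space. For $\epsilon>0$ let $\mathcal N_\epsilon(X)\in\mathbb N\cup\{\infty\}$ be the least number of open balls of radius $\epsilon$, centred in $X$, that cover $X$. For $\beta>0$ put $\mathrm{ord}_\beta(\epsilon)=\exp(-\epsilon^{-\beta})$ and $$\mathcal H^{\mathrm{ord}_\beta}(X)=\lim_{\epsilon\to0}\ \inf\Big\{\sum_{j\in J}\mathrm{ord}_\beta(r_j)\Big\},$$ the infimum being over the countable coverings of $X$ by balls $B(x_j,r_j)$, $j\in J$, with $x_j\in X$ and $0<r_j\le\epsilon$. The lower box, upper box, Hausdorff and packing orders of $X$ are the following elements of $[0,\infty]$ (with $\sup\emptyset=0$, $\inf\emptyset=\infty$): $$\underline{\mathsf{ord}}_B X=\sup\{\beta>0:\mathcal N_\epsilon(X)\,\mathrm{ord}_\beta(\epsilon)\xrightarrow[\epsilon\to0]{}+\infty\},\qquad \overline{\mathsf{ord}}_B X=\inf\{\beta>0:\mathcal N_\epsilon(X)\,\mathrm{ord}_\beta(\epsilon)\xrightarrow[\epsilon\to0]{}0\},$$ $$\mathsf{ord}_H X=\sup\{\beta>0:\mathcal H^{\mathrm{ord}_\beta}(X)=+\infty\},\qquad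 \mathsf{ord}_P X=\inf\Big\{\sup_{n\ge1}\overline{\mathsf{ord}}_B E_n:\ X=\bigcup_{n\ge1}E_n\Big\},$$ where subsets $E_n\subset X$ carry the induced metric. Theorem. Let $d\ge1$ and $k\ge0$ be integers and $\alpha\in[0,1]$. Let $\mathcal F^{d,k,\alpha}$ be the set of functions $f\in C^k([0,1]^d,[-1,1])$ such that $\|D^jf(x)\|\le1$ for all $0\le j\le k$ and $x\in[0,1]^d$ and, if $\alpha>0$, $\|D^kf(x)-D^kf(y)\|\le\|x-y\|^\alpha$ for all $x,y\in[0,1]^d$, where $\mathbb R^d$ carries the Euclidean norm and $D^jf(x)$ the operator norm of $j$-linear forms. Endow $\mathcal F^{d,k,\alpha}$ with the distance of the sup norm. Then $$\mathsf{ord}_H\mathcal F^{d,k,\alpha}=\mathsf{ord}_P\mathcal F^{d,k,\alpha}=\underline{\mathsf{ord}}_B\mathcal F^{d,k,\alpha}=\overline{\mathsf{ord}}_B\mathcal F^{d,k,\alpha}=\frac d{k+\alpha},$$ where $\frac d{k+\alpha}=+\infty$ if $k=\alpha=0$. -/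

import Mathlib

open Set Filter Topology
open scoped ENNReal

noncomputable section

namespace MetricScale

/-! ### Scales of metric spaces

A growth is a family `scl α : ℝ → ℝ` indexed by `α > 0`, of which only the values on `(0, 1)` with
`α > 0` matter. Scales take their values in `[0, ∞]`, so that `sup ∅ = 0` and `inf ∅ = ∞`. -/

/-- The growth of orders: `ord_α(ε) = exp (-ε ^ (-α))`. -/
def ord (α ε : ℝ) : ℝ := Real.exp (-(ε ^ (-α)))

/-- The covering number: least cardinality of a covering of `X` by open balls of radius `ε`
centred in `X`; it is `⊤` if there is no finite such covering. -/
def coveringNumber (X : Type*) [PseudoMetricSpace X] (ε : ℝ) : ℕ∞ :=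
  ⨅ (C : Set X) (_ : (⋃ x ∈ C, Metric.ball x ε) = univ), C.encard

/-- The lower box scale. -/
def lowerBoxScale (scl : ℝ → ℝ → ℝ) (X : Type*) [PseudoMetricSpace X] : ℝ≥0∞ :=
  ⨆ (α : ℝ) (_ : 0 < α ∧
    Tendsto (fun ε : ℝ => (coveringNumber X ε : ℝ≥0∞) * ENNReal.ofReal (scl α ε))
      (𝓝[>] 0) (𝓝 ⊤)), ENNReal.ofReal α

/-- The upper box scale. -/
def upperBoxScale (scl : ℝ → ℝ → ℝ) (X : Type*) [PseudoMetricSpace X] : ℝ≥0∞ :=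
  ⨅ (α : ℝ) (_ : 0 < α ∧
    Tendsto (fun ε : ℝ => (coveringNumber X ε : ℝ≥0∞) * ENNReal.ofReal (scl α ε))
      (𝓝[>] 0) (𝓝 0)), ENNReal.ofReal α

/-- `H_ε^φ(X)`: infimum of `∑ φ(radius)` over the countable coverings of `X` by balls of radius at
most `ε`. A ball is given by its centre and its radius. -/
def hausdorffPre (φ : ℝ → ℝ) (X : Type*) [PseudoMetricSpace X] (ε : ℝ) : ℝ≥0∞ :=
  ⨅ (J : Set (X × ℝ)) (_ : J.Countable ∧ (∀ b ∈ J, 0 < b.2 ∧ b.2 ≤ ε) ∧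
    (⋃ b ∈ J, Metric.ball b.1 b.2) = univ), ∑' b : J, ENNReal.ofReal (φ b.1.2)

/-- The Hausdorff `φ`-measure of `X`, the limit of `H_ε^φ(X)` as `ε → 0`. As `H_ε^φ(X)` is
nonincreasing in `ε`, the limit is a supremum. -/
def hausdorffMeas (φ : ℝ → ℝ) (X : Type*) [PseudoMetricSpace X] : ℝ≥0∞ :=
  ⨆ ε ∈ Ioo (0 : ℝ) 1, hausdorffPre φ X ε

/-- The Hausdorff scale. -/
def hausdorffScale (scl : ℝ → ℝ → ℝ) (X : Type*) [PseudoMetricSpace X] : ℝ≥0∞ :=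
  ⨆ (α : ℝ) (_ : 0 < α ∧ hausdorffMeas (scl α) X = ⊤), ENNReal.ofReal α

/-- The packing scale: the upper box scale made countably stable. -/
def packingScale (scl : ℝ → ℝ → ℝ) (X : Type*) [PseudoMetricSpace X] : ℝ≥0∞ :=
  ⨅ (E : ℕ → Set X) (_ : (⋃ n, E n) = univ), ⨆ n, upperBoxScale scl (E n)

/-! ### The functional spaces -/

/-- The cube `[0, 1]^d` in Euclidean space. -/
def cube (d : ℕ) : Set (EuclideanSpace ℝ (Fin d)) := {x | ∀ i, x i ∈ Icc (0 : ℝ) 1}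

theorem isCompact_cube (d : ℕ) : IsCompact (cube d) := by
  have h : IsCompact (Set.pi univ fun _ : Fin d => Icc (0 : ℝ) 1) :=
    isCompact_univ_pi fun _ => isCompact_Icc
  have h2 := (EuclideanSpace.equiv (Fin d) ℝ).toHomeomorph.isCompact_preimage.2 h
  convert h2 using 1
  ext x
  exact ⟨fun hx i _ => hx i, fun hx i => hx i (mem_univ i)⟩

instance (d : ℕ) : CompactSpace (cube d) := isCompact_iff_compactSpace.1 (isCompact_cube d)

/-- The space `F^{d,k,α}`, as a subset of the continuous functions on the cube with the sup norm.
Derivatives are taken within the cube, so that they do not depend on the extension `g` of `f`.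
The case `j = 0` of the bound says that `f` takes its values in `[-1, 1]`. -/
def funSpace (d k : ℕ) (α : ℝ) : Set C(cube d, ℝ) :=
  {f | ∃ g : EuclideanSpace ℝ (Fin d) → ℝ,
    (∀ x : cube d, g x = f x) ∧
    ContDiffOn ℝ k g (cube d) ∧
    (∀ j ≤ k, ∀ x ∈ cube d, ‖iteratedFDerivWithin ℝ j g (cube d) x‖ ≤ 1) ∧
    (0 < α → ∀ x ∈ cube d, ∀ y ∈ cube d,
      ‖iteratedFDerivWithin ℝ k g (cube d) x - iteratedFDerivWithin ℝ k g (cube d) y‖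
        ≤ ‖x - y‖ ^ α)}

end MetricScale

end

/-!
All four scales lie between the Hausdorff order and the upper box order, so it suffices to bound the
first from below and the second from above by `d / s`, where `s = k + α`.

*Upper bound.* By Taylor's formula, `f` is determined up to `O(η + δ ^ s)` by its derivatives of
order at most `k`, known within `η` on a grid of mesh `δ`. With `η = δ ^ s ≈ ε`, this leaves
`exp (O(ε ^ (-d / s) * log (1 / ε)))` possibilities.

*Lower bound.* For `t > s`, superpose for every `n` bumps of width `b ^ (-n)` and height
`c * b ^ (-t * n)`, centred at an arbitrary subset of the grid of mesh `b ^ (-n)`. These series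
belong to the space, and two of them whose choices differ at step `n` are at distance at least a
constant times `b ^ (-t * n)`. There are `2 ^ (b ^ (n * d))` choices at step `n`, so the uniform
measure on the product of the choices gives to a ball of radius `r ≈ b ^ (-t * n)` a mass at most
`2 ^ (-b ^ (n * d))`, which is `o(ord_β(r))` for `β < d / t`.
-/

namespace MetricScale

/-! ### Covering numbers -/

section CoveringNumber

variable {X Y : Type*} [PseudoMetricSpace X] [PseudoMetricSpace Y] {ε : ℝ}

theorem coveringNumber_le_encard {C : Set X} (hC : (⋃ x ∈ C, Metric.ball x ε) = univ) :
    coveringNumber X ε ≤ C.encard :=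
  iInf₂_le C hC

theorem exists_finite_cover_of_coveringNumber_ne_top (h : coveringNumber X ε ≠ ⊤) :
    ∃ C : Set X, C.Finite ∧ (⋃ x ∈ C, Metric.ball x ε) = univ ∧ C.encard = coveringNumber X ε := by
  rw [coveringNumber, iInf_subtype'] at h
  have : Nonempty {C : Set X // (⋃ x ∈ C, Metric.ball x ε) = univ} := by
    by_contra! hempty
    exact h (iInf_of_empty _)
  obtain ⟨⟨C, hC⟩, hCard⟩ :=
    ciInf_mem fun C : {C : Set X // (⋃ x ∈ C, Metric.ball x ε) = univ} => C.1.encard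
  refine ⟨C, encard_ne_top_iff.1 (hCard.trans_ne h), hC, ?_⟩
  rw [coveringNumber, iInf_subtype']
  exact hCard

theorem coveringNumber_le_of_surjective {f : X → Y} (hf : LipschitzWith 1 f)
    (hsurj : Function.Surjective f) : coveringNumber Y ε ≤ coveringNumber X ε := by
  refine le_iInf₂ fun C hC => (coveringNumber_le_encard ?_).trans (encard_image_le f C)
  rw [biUnion_image, eq_univ_iff_forall]
  intro y
  obtain ⟨x, rfl⟩ := hsurj y
  obtain ⟨z, hz, hxz⟩ := mem_iUnion₂.1 (hC ▸ mem_univ x)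
  exact mem_iUnion₂.2 ⟨z, hz, by simpa using (hf.dist_le_mul x z).trans_lt (by simpa using hxz)⟩

theorem coveringNumber_univ_le : coveringNumber (univ : Set X) ε ≤ coveringNumber X ε :=
  coveringNumber_le_of_surjective (f := (Equiv.Set.univ X).symm)
    (LipschitzWith.of_dist_le_mul fun _ _ => by simp [Subtype.dist_eq])
    (Equiv.Set.univ X).symm.surjective

theorem coveringNumber_le_card {ι : Type*} [Fintype ι] (R : X → ι)
    (hR : ∀ x y, R x = R y → dist x y < ε) : coveringNumber X ε ≤ Fintype.card ι := by
  classical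
  choose s hs using fun i : range R => i.2
  calc coveringNumber X ε ≤ (range s).encard := coveringNumber_le_encard <| by
        rw [biUnion_range, eq_univ_iff_forall]
        exact fun x => mem_iUnion.2 ⟨⟨R x, x, rfl⟩, hR _ _ (hs ⟨R x, x, rfl⟩).symm⟩
    _ ≤ (univ : Set (range R)).encard := image_univ (f := s) ▸ encard_image_le s univ
    _ = (range R).encard := encard_univ _
    _ ≤ (univ : Set ι).encard := encard_le_encard (subset_univ _)
    _ = Fintype.card ι := by rw [encard_univ, ENat.card_eq_coe_fintype_card]

theorem coveringNumber_le_pow_of_coordinates {ι : Type*} [Fintype ι] {M : ℕ} (hM : 0 < M)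
    (F : X → ι → ℝ) (hF : ∀ x i, |F x i| ≤ 1)
    (hdist : ∀ x y, (∀ i, |F x i - F y i| ≤ (M : ℝ)⁻¹) → dist x y < ε) :
    coveringNumber X ε ≤ ((2 * M + 1) ^ Fintype.card ι : ℕ) := by
  classical
  have hM' : (0 : ℝ) < M := by exact_mod_cast hM
  have hfloor (x : X) (i : ι) : ⌊F x i * M⌋ ∈ Finset.Icc (-M : ℤ) M := by
    obtain ⟨hlow, hupp⟩ := abs_le.1 (hF x i)
    rw [Finset.mem_Icc, Int.le_floor, ← Int.lt_add_one_iff, Int.floor_lt]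
    push_cast
    constructor <;> nlinarith
  convert coveringNumber_le_card (fun x i => (⟨⌊F x i * M⌋, hfloor x i⟩ : Finset.Icc (-M : ℤ) M))
    (fun x y hxy => hdist x y fun i => ?_) using 2
  · rw [Fintype.card_fun, Fintype.card_coe, Int.card_Icc]
    congr 1
    omega
  · have hsub := Int.abs_sub_lt_one_of_floor_eq_floor (Subtype.ext_iff.1 (congrFun hxy i))
    rw [← sub_mul, abs_mul, abs_of_pos hM'] at hsub
    rw [inv_eq_one_div, le_div_iff₀ hM']
    exact hsub.le

end CoveringNumber

/-! ### Comparison of the scales -/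

/-- The properties of a growth `scl` under which the four scales are comparable: near `0`, the
functions `scl α` are positive and decrease as `α` increases. -/
structure IsScaling (scl : ℝ → ℝ → ℝ) : Prop where
  eventually_pos : ∀ α > 0, ∀ᶠ ε in 𝓝[>] 0, 0 < scl α ε
  eventually_le : ∀ α > 0, ∀ β ≥ α, ∀ᶠ ε in 𝓝[>] 0, scl β ε ≤ scl α ε

theorem ord_pos (β ε : ℝ) : 0 < ord β ε := Real.exp_pos _

theorem ord_le_ord {α β ε : ℝ} (h : α ≤ β) (hε : 0 < ε) (hε1 : ε ≤ 1) : ord β ε ≤ ord α ε :=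
  Real.exp_le_exp.2 <| neg_le_neg <| Real.rpow_le_rpow_of_exponent_ge hε hε1 (neg_le_neg h)

theorem isScaling_ord : IsScaling ord where
  eventually_pos α _ := Eventually.of_forall (ord_pos α)
  eventually_le _ _ _ h := by
    filter_upwards [Ioc_mem_nhdsGT one_pos] with ε hε using ord_le_ord h hε.1 hε.2

theorem tsum_snd_image_le {X Y : Type*} (φ : ℝ → ℝ) (r : ℝ) (f : Y → X) (C : Set Y) :
    ∑' b : ((fun y => (f y, r)) '' C : Set (X × ℝ)), ENNReal.ofReal (φ b.1.2) ≤
      (C.encard : ℝ≥0∞) * ENNReal.ofReal (φ r) := by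
  have hconst : ∀ b : ((fun y => (f y, r)) '' C : Set (X × ℝ)),
      ENNReal.ofReal (φ b.1.2) = ENNReal.ofReal (φ r) := by
    rintro ⟨_, y, _, rfl⟩
    rfl
  rw [tsum_congr hconst, ENNReal.tsum_set_const]
  gcongr
  exact encard_image_le _ _

section HausdorffPre

variable {X : Type*} [PseudoMetricSpace X] {φ : ℝ → ℝ} {ε ε' : ℝ}

theorem hausdorffPre_le {J : Set (X × ℝ)} (hJ : J.Countable) (hr : ∀ b ∈ J, 0 < b.2 ∧ b.2 ≤ ε)
    (hcov : (⋃ b ∈ J, Metric.ball b.1 b.2) = univ) :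
    hausdorffPre φ X ε ≤ ∑' b : J, ENNReal.ofReal (φ b.1.2) :=
  iInf₂_le J ⟨hJ, hr, hcov⟩

theorem hausdorffPre_anti (h : ε ≤ ε') : hausdorffPre φ X ε' ≤ hausdorffPre φ X ε :=
  le_iInf₂ fun _ ⟨hJ, hr, hcov⟩ =>
    hausdorffPre_le hJ (fun b hb => ⟨(hr b hb).1, (hr b hb).2.trans h⟩) hcov

theorem hausdorffPre_le_hausdorffMeas (hε : 0 < ε) : hausdorffPre φ X ε ≤ hausdorffMeas φ X :=
  (hausdorffPre_anti (min_le_left ε (1 / 2))).trans <|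
    le_iSup₂_of_le (min ε (1 / 2)) ⟨by positivity, min_lt_of_right_lt one_half_lt_one⟩ le_rfl

theorem hausdorffPre_le_tsum_coveringNumber {ι : Type*} [Countable ι] {E : ι → Set X}
    (hE : (⋃ i, E i) = univ) {r : ι → ℝ} (hr : ∀ i, r i ∈ Ioc 0 ε) (hφ : ∀ i, 0 < φ (r i)) :
    hausdorffPre φ X ε ≤
      ∑' i, (coveringNumber (E i) (r i) : ℝ≥0∞) * ENNReal.ofReal (φ (r i)) := by
  by_cases hfin : ∀ i, coveringNumber (E i) (r i) ≠ ⊤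
  swap
  · obtain ⟨i, hi⟩ := not_forall_not.1 hfin
    refine le_of_le_of_eq le_top (ENNReal.tsum_eq_top_of_eq_top ⟨i, ?_⟩).symm
    rw [hi, ENat.toENNReal_top, ENNReal.top_mul (ENNReal.ofReal_pos.2 (hφ i)).ne']
  choose C hCfin hC hcard using fun i => exists_finite_cover_of_coveringNumber_ne_top (hfin i)
  let J (i : ι) : Set (X × ℝ) := (fun x : E i => ((x : X), r i)) '' C i
  have hJ : (⋃ i, J i).Countable := countable_iUnion fun i => (hCfin i).countable.image _
  have hJr : ∀ b ∈ ⋃ i, J i, 0 < b.2 ∧ b.2 ≤ ε := by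
    intro b hb
    obtain ⟨i, x, _, rfl⟩ := mem_iUnion.1 hb
    exact hr i
  have hJcov : (⋃ b ∈ ⋃ i, J i, Metric.ball b.1 b.2) = univ := by
    refine eq_univ_iff_forall.2 fun y => ?_
    obtain ⟨i, hi⟩ := mem_iUnion.1 (hE ▸ mem_univ y)
    obtain ⟨x, hx, hyx⟩ := mem_iUnion₂.1 (hC i ▸ mem_univ (⟨y, hi⟩ : E i))
    exact mem_iUnion₂.2 ⟨(x, r i), mem_iUnion.2 ⟨i, x, hx, rfl⟩, hyx⟩
  calc hausdorffPre φ X ε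
      ≤ ∑' b : (⋃ i, J i : Set (X × ℝ)), ENNReal.ofReal (φ b.1.2) := hausdorffPre_le hJ hJr hJcov
    _ ≤ ∑' i, ∑' b : J i, ENNReal.ofReal (φ b.1.2) :=
        ENNReal.tsum_iUnion_le_tsum (fun b : X × ℝ => ENNReal.ofReal (φ b.2)) J
    _ ≤ ∑' i, (coveringNumber (E i) (r i) : ℝ≥0∞) * ENNReal.ofReal (φ (r i)) :=
        ENNReal.tsum_le_tsum fun i => hcard i ▸ tsum_snd_image_le φ (r i) _ (C i)

theorem hausdorffPre_le_coveringNumber_mul (hε : 0 < ε) (hφ : 0 < φ ε) :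
    hausdorffPre φ X ε ≤ (coveringNumber X ε : ℝ≥0∞) * ENNReal.ofReal (φ ε) := by
  calc hausdorffPre φ X ε
      ≤ ∑' _ : Unit, (coveringNumber (univ : Set X) ε : ℝ≥0∞) * ENNReal.ofReal (φ ε) :=
        hausdorffPre_le_tsum_coveringNumber (iUnion_const univ) (fun _ => ⟨hε, le_rfl⟩) fun _ => hφ
    _ = (coveringNumber (univ : Set X) ε : ℝ≥0∞) * ENNReal.ofReal (φ ε) := by
        rw [tsum_fintype, Finset.sum_const, Finset.card_univ, Fintype.card_unit, one_smul]
    _ ≤ (coveringNumber X ε : ℝ≥0∞) * ENNReal.ofReal (φ ε) := by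
        gcongr
        exact coveringNumber_univ_le

theorem hausdorffMeas_eq_zero_of_iUnion {ι : Type*} [Countable ι] {E : ι → Set X}
    (hE : (⋃ i, E i) = univ) (hφ : ∀ᶠ ε in 𝓝[>] 0, 0 < φ ε)
    (hlim : ∀ i, Tendsto (fun ε : ℝ => (coveringNumber (E i) ε : ℝ≥0∞) * ENNReal.ofReal (φ ε))
      (𝓝[>] 0) (𝓝 0)) :
    hausdorffMeas φ X = 0 := by
  refine le_antisymm (iSup₂_le fun ε hε => le_of_forall_pos_le_add fun η hη => ?_) zero_le
  obtain ⟨δ, hδ, hsum⟩ := ENNReal.exists_pos_sum_of_countable hη.ne' ι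
  have hsmall : ∀ᶠ r in 𝓝[>] 0, r ∈ Ioc 0 ε := Ioc_mem_nhdsGT hε.1
  have hradius (i : ι) : ∃ r, r ∈ Ioc 0 ε ∧ 0 < φ r ∧
      (coveringNumber (E i) r : ℝ≥0∞) * ENNReal.ofReal (φ r) < δ i :=
    (hsmall.and (hφ.and ((hlim i).eventually_lt_const (ENNReal.coe_pos.2 (hδ i))))).exists
  choose r hr hφr hlt using hradius
  rw [zero_add]
  exact (hausdorffPre_le_tsum_coveringNumber hE hr hφr).trans <|
    (ENNReal.tsum_le_tsum fun i => (hlt i).le).trans hsum.le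

end HausdorffPre

section Comparison

variable {scl : ℝ → ℝ → ℝ} {X : Type*} [PseudoMetricSpace X]

theorem IsScaling.tendsto_coveringNumber_mul_of_le (hscl : IsScaling scl) {α β : ℝ} (hα : 0 < α)
    (hαβ : α ≤ β)
    (hlim : Tendsto (fun ε : ℝ => (coveringNumber X ε : ℝ≥0∞) * ENNReal.ofReal (scl α ε))
      (𝓝[>] 0) (𝓝 0)) :
    Tendsto (fun ε : ℝ => (coveringNumber X ε : ℝ≥0∞) * ENNReal.ofReal (scl β ε))
      (𝓝[>] 0) (𝓝 0) := by
  refine tendsto_of_tendsto_of_tendsto_of_le_of_le' tendsto_const_nhds hlim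
    (Eventually.of_forall fun _ => zero_le) ?_
  filter_upwards [hscl.eventually_le α hα β hαβ] with ε hε
  gcongr

theorem IsScaling.tendsto_coveringNumber_mul_of_upperBoxScale_lt (hscl : IsScaling scl) {β : ℝ}
    (hβ : upperBoxScale scl X < ENNReal.ofReal β) :
    Tendsto (fun ε : ℝ => (coveringNumber X ε : ℝ≥0∞) * ENNReal.ofReal (scl β ε))
      (𝓝[>] 0) (𝓝 0) := by
  simp only [upperBoxScale, iInf_lt_iff] at hβ
  obtain ⟨α, ⟨hα, hlim⟩, hαβ⟩ := hβ
  exact hscl.tendsto_coveringNumber_mul_of_le hα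
    ((ENNReal.ofReal_lt_ofReal_iff_of_nonneg hα.le).1 hαβ).le hlim

theorem IsScaling.hausdorffScale_le_lowerBoxScale (hscl : IsScaling scl) :
    hausdorffScale scl X ≤ lowerBoxScale scl X := by
  refine iSup₂_le fun β ⟨hβ, htop⟩ => le_iSup₂_of_le β ⟨hβ, ?_⟩ le_rfl
  refine ENNReal.tendsto_nhds_top_iff_nnreal.2 fun M => ?_
  have hM : (M : ℝ≥0∞) < hausdorffMeas (scl β) X := htop ▸ ENNReal.coe_lt_top
  simp only [hausdorffMeas, lt_iSup_iff] at hM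
  obtain ⟨ε, hε, hlt⟩ := hM
  filter_upwards [Ioc_mem_nhdsGT hε.1, hscl.eventually_pos β hβ] with r hr hpos
  exact hlt.trans_le <| (hausdorffPre_anti hr.2).trans <|
    hausdorffPre_le_coveringNumber_mul hr.1 hpos

theorem IsScaling.lowerBoxScale_le_upperBoxScale (hscl : IsScaling scl) :
    lowerBoxScale scl X ≤ upperBoxScale scl X := by
  refine iSup₂_le fun β ⟨_, htop⟩ => not_lt.1 fun hlt => ENNReal.top_ne_zero ?_
  exact tendsto_nhds_unique htop (hscl.tendsto_coveringNumber_mul_of_upperBoxScale_lt hlt)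

theorem packingScale_le_upperBoxScale : packingScale scl X ≤ upperBoxScale scl X := by
  refine iInf₂_le_of_le (fun _ => univ) (iUnion_const _) (iSup_le fun _ => ?_)
  refine le_iInf₂ fun β ⟨hβ, hlim⟩ => iInf₂_le β ⟨hβ, ?_⟩
  refine tendsto_of_tendsto_of_tendsto_of_le_of_le tendsto_const_nhds hlim
    (fun _ => zero_le) fun ε => ?_
  dsimp only
  gcongr
  exact coveringNumber_univ_le

theorem IsScaling.hausdorffScale_le_packingScale (hscl : IsScaling scl) :
    hausdorffScale scl X ≤ packingScale scl X := by
  refine iSup₂_le fun β ⟨hβ, htop⟩ => le_iInf₂ fun E hE => not_lt.1 fun hlt => ?_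
  have hzero : hausdorffMeas (scl β) X = 0 :=
    hausdorffMeas_eq_zero_of_iUnion hE (hscl.eventually_pos β hβ) fun n =>
      hscl.tendsto_coveringNumber_mul_of_upperBoxScale_lt ((le_iSup _ n).trans_lt hlt)
  exact ENNReal.top_ne_zero (htop.symm.trans hzero)

end Comparison

/-! ### Mass distribution -/

section MassDistribution

variable {X : Type*} [PseudoMetricSpace X] {φ : ℝ → ℝ}

theorem outerMeasure_univ_le_hausdorffMeas (μ : MeasureTheory.OuterMeasure X)
    (hμ : ∀ᶠ r in 𝓝[>] 0, ∀ x, μ (Metric.ball x r) ≤ ENNReal.ofReal (φ r)) :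
    μ univ ≤ hausdorffMeas φ X := by
  obtain ⟨ε, hε, hball⟩ := mem_nhdsGT_iff_exists_Ioc_subset.1 hμ
  refine le_trans (le_iInf₂ fun J ⟨hJ, hr, hcov⟩ => ?_) (hausdorffPre_le_hausdorffMeas hε)
  calc μ univ = μ (⋃ b ∈ J, Metric.ball b.1 b.2) := by rw [hcov]
    _ ≤ ∑' b : J, μ (Metric.ball b.1.1 b.1.2) := MeasureTheory.measure_biUnion_le μ hJ _
    _ ≤ ∑' b : J, ENNReal.ofReal (φ b.1.2) :=
        ENNReal.tsum_le_tsum fun b => hball (hr b b.2) b.1.1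

theorem exists_uniform_outerMeasure_pi {ι : Type*} (Ω : ι → Type*) [∀ i, Fintype (Ω i)]
    [∀ i, Nonempty (Ω i)] :
    ∃ μ : MeasureTheory.OuterMeasure (∀ i, Ω i), μ univ = 1 ∧
      ∀ i w, μ {σ | σ i = w} = (Fintype.card (Ω i) : ℝ≥0∞)⁻¹ := by
  let : ∀ i, MeasurableSpace (Ω i) := fun _ => ⊤
  let u (i : ι) : MeasureTheory.Measure (Ω i) := (PMF.uniformOfFintype (Ω i)).toMeasure
  refine ⟨(MeasureTheory.Measure.infinitePi u).toOuterMeasure,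
    MeasureTheory.measure_univ (μ := MeasureTheory.Measure.infinitePi u), fun i w => ?_⟩
  calc MeasureTheory.Measure.infinitePi u {σ | σ i = w} = u i {w} :=
        (measurePreserving_eval_infinitePi u i).measure_preimage
          (MeasurableSet.nullMeasurableSet (s := {w}) trivial)
    _ = (Fintype.card (Ω i) : ℝ≥0∞)⁻¹ := by
        rw [PMF.toMeasure_apply_singleton _ _ MeasurableSpace.measurableSet_top,
          PMF.uniformOfFintype_apply]

theorem le_hausdorffMeas_of_separated {ι : Type*} {Ω : ι → Type*} [∀ i, Fintype (Ω i)]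
    [∀ i, Nonempty (Ω i)] (Φ : (∀ i, Ω i) → X) {a : ι → ℝ}
    (hsep : ∀ σ τ i, σ i ≠ τ i → 2 * a i ≤ dist (Φ σ) (Φ τ)) {K : ℝ≥0∞}
    (hK : ∀ᶠ r in 𝓝[>] 0, ∃ i, r ≤ a i ∧
      K * (Fintype.card (Ω i) : ℝ≥0∞)⁻¹ ≤ ENNReal.ofReal (φ r)) :
    K ≤ hausdorffMeas φ X := by
  obtain ⟨μ, hμ, hcyl⟩ := exists_uniform_outerMeasure_pi Ω
  let ν : MeasureTheory.OuterMeasure X := K • MeasureTheory.OuterMeasure.map Φ μ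
  have hν (s : Set X) : ν s = K * μ (Φ ⁻¹' s) := by
    rw [smul_apply, MeasureTheory.OuterMeasure.map_apply, smul_eq_mul]
  calc K = ν univ := by rw [hν, preimage_univ, hμ, mul_one]
    _ ≤ hausdorffMeas φ X := outerMeasure_univ_le_hausdorffMeas ν ?_
  filter_upwards [hK] with r ⟨i, hr, hle⟩ x
  rw [hν]
  refine le_trans ?_ hle
  gcongr
  rcases (Φ ⁻¹' Metric.ball x r).eq_empty_or_nonempty with hempty | ⟨τ, hτ⟩
  · rw [hempty, MeasureTheory.measure_empty]
    exact zero_le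
  rw [← hcyl i (τ i)]
  refine MeasureTheory.measure_mono fun σ hσ => by_contra fun hne => ?_
  have hdist : dist (Φ σ) (Φ τ) < r + r :=
    (dist_triangle_right _ _ x).trans_lt (add_lt_add hσ hτ)
  linarith [hsep σ τ i hne]

end MassDistribution

theorem eventually_exists_pow_bracket {c θ : ℝ} (hc : 0 < c) (hθ : θ ∈ Ioo 0 1) (n₀ : ℕ) :
    ∀ᶠ r in 𝓝[>] 0, ∃ n ≥ n₀, c * θ ^ (n + 1) < r ∧ r ≤ c * θ ^ n := by
  obtain ⟨hθ0, hθ1⟩ := hθ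
  filter_upwards [Ioc_mem_nhdsGT (show 0 < c * θ ^ n₀ by positivity)] with r ⟨hr0, hr⟩
  have hrc : r / c ≤ θ ^ n₀ := by rwa [div_le_iff₀' hc]
  obtain ⟨n, hlow, hupp⟩ := exists_nat_pow_near_of_lt_one (div_pos hr0 hc)
    (hrc.trans (pow_le_one₀ hθ0.le hθ1.le)) hθ0 hθ1
  have hn : n₀ < n + 1 := (pow_lt_pow_iff_right_of_lt_one₀ hθ0 hθ1).1 (hlow.trans_le hrc)
  exact ⟨n, Nat.lt_succ_iff.1 hn, (lt_div_iff₀' hc).1 hlow, (div_le_iff₀' hc).1 hupp⟩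

theorem tendsto_mul_pow_sub_mul_pow {p D x y : ℝ} (hp : 0 < p) (hx : 0 ≤ x) (hxy : x < y)
    (hy : 1 < y) : Tendsto (fun n : ℕ => p * y ^ n - D * x ^ n) atTop atTop := by
  have hratio : Tendsto (fun n : ℕ => (x / y) ^ n) atTop (𝓝 0) :=
    tendsto_pow_atTop_nhds_zero_of_lt_one (by positivity) ((div_lt_one (by linarith)).2 hxy)
  have hfactor : Tendsto (fun n : ℕ => p - D * (x / y) ^ n) atTop (𝓝 p) := by
    simpa using tendsto_const_nhds.sub (hratio.const_mul D)
  refine ((tendsto_pow_atTop_atTop_of_one_lt hy).atTop_mul_pos hp hfactor).congr fun n => ?_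
  have hyn : y ^ n ≠ 0 := by positivity
  rw [div_pow]
  field_simp

theorem eventually_exists_le_mul_exp_le_ord {β c θ y p K : ℝ} (hβ : 0 ≤ β) (hc : 0 < c)
    (hθ : θ ∈ Ioo 0 1) (hy : 1 < y) (hθy : θ ^ (-β) < y) (hp : 0 < p) (hK : 0 < K) :
    ∀ᶠ r in 𝓝[>] 0, ∃ n : ℕ, r ≤ c * θ ^ n ∧ K * Real.exp (-(p * y ^ n)) ≤ ord β r := by
  have hθ0 : 0 < θ := hθ.1
  obtain ⟨n₀, hn₀⟩ := ((tendsto_mul_pow_sub_mul_pow (D := c ^ (-β) * θ ^ (-β)) hp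
    (by positivity) hθy hy).eventually_ge_atTop (Real.log K)).exists_forall_of_atTop
  filter_upwards [eventually_exists_pow_bracket hc hθ n₀] with r ⟨n, hn, hlow, hupp⟩
  refine ⟨n, hupp, ?_⟩
  have hrβ : r ^ (-β) ≤ c ^ (-β) * θ ^ (-β) * (θ ^ (-β)) ^ n := by
    calc r ^ (-β) ≤ (c * θ ^ (n + 1)) ^ (-β) :=
          Real.rpow_le_rpow_of_nonpos (by positivity) hlow.le (by linarith)
      _ = c ^ (-β) * (θ ^ (-β)) ^ (n + 1) := by
          rw [Real.mul_rpow hc.le (by positivity), Real.rpow_pow_comm hθ0.le]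
      _ = c ^ (-β) * θ ^ (-β) * (θ ^ (-β)) ^ n := by ring
  calc K * Real.exp (-(p * y ^ n)) = Real.exp (Real.log K - p * y ^ n) := by
        rw [sub_eq_add_neg, Real.exp_add, Real.exp_log hK]
    _ ≤ ord β r := Real.exp_le_exp.2 (by linarith [hn₀ n hn])

theorem hausdorffMeas_ord_eq_top_of_separated {X : Type*} [PseudoMetricSpace X] {Ω : ℕ → Type*}
    [∀ n, Fintype (Ω n)] [∀ n, Nonempty (Ω n)] (Φ : (∀ n, Ω n) → X) {β c θ y p : ℝ} (hβ : 0 ≤ β)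
    (hc : 0 < c) (hθ : θ ∈ Ioo 0 1) (hy : 1 < y) (hθy : θ ^ (-β) < y) (hp : 0 < p)
    (hcard : ∀ n, Real.exp (p * y ^ n) ≤ Fintype.card (Ω n))
    (hsep : ∀ σ τ n, σ n ≠ τ n → c * θ ^ n ≤ dist (Φ σ) (Φ τ)) :
    hausdorffMeas (ord β) X = ⊤ := by
  refine ENNReal.eq_top_of_forall_nnreal_le fun K => ?_
  refine le_hausdorffMeas_of_separated Φ (a := fun n => c / 2 * θ ^ n)
    (fun σ τ n hne => by linarith [hsep σ τ n hne]) ?_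
  filter_upwards [eventually_exists_le_mul_exp_le_ord (K := K + 1) hβ (half_pos hc) hθ hy hθy hp
    (by positivity)] with r ⟨n, hr, hle⟩
  refine ⟨n, hr, ?_⟩
  have hcard_inv : (Fintype.card (Ω n) : ℝ)⁻¹ ≤ Real.exp (-(p * y ^ n)) := by
    rw [Real.exp_neg]
    exact inv_anti₀ (Real.exp_pos _) (hcard n)
  calc (K : ℝ≥0∞) * (Fintype.card (Ω n) : ℝ≥0∞)⁻¹
      = ENNReal.ofReal (K * (Fintype.card (Ω n) : ℝ)⁻¹) := by
        rw [ENNReal.ofReal_mul K.coe_nonneg, ENNReal.ofReal_coe_nnreal,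
          ENNReal.ofReal_inv_of_pos (by exact_mod_cast Fintype.card_pos), ENNReal.ofReal_natCast]
    _ ≤ ENNReal.ofReal (ord β r) := by
        gcongr
        refine le_trans ?_ hle
        gcongr
        linarith

/-! ### Hölder bounds -/

section HolderBounds

variable {E F : Type*} [NormedAddCommGroup E] [NormedSpace ℝ E] [NormedAddCommGroup F]
  [NormedSpace ℝ F]

/-- `f` belongs to the ball of radius `A` of the Hölder space `C^{k,α}` of `s`: its derivatives of
order at most `k` are bounded by `A`, and the last one is `α`-Hölder with constant `A`. For `α = 0`
the last condition only bounds the oscillation. -/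
structure HolderBoundOn (k : ℕ) (α A : ℝ) (f : E → F) (s : Set E) : Prop where
  contDiffOn : ContDiffOn ℝ k f s
  norm_le : ∀ j ≤ k, ∀ x ∈ s, ‖iteratedFDerivWithin ℝ j f s x‖ ≤ A
  holder_le : ∀ x ∈ s, ∀ y ∈ s,
    ‖iteratedFDerivWithin ℝ k f s x - iteratedFDerivWithin ℝ k f s y‖ ≤ A * ‖x - y‖ ^ α

theorem norm_iteratedFDerivWithin_sub_le {k j : ℕ} {B : ℝ} {f : E → F} {s t : Set E}
    (hs : UniqueDiffOn ℝ s) (hf : ContDiffOn ℝ k f s) (hj : j < k) (hts : t ⊆ s) (ht : Convex ℝ t)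
    (hB : ∀ z ∈ t, ‖iteratedFDerivWithin ℝ (j + 1) f s z‖ ≤ B) {x y : E} (hx : x ∈ t)
    (hy : y ∈ t) :
    ‖iteratedFDerivWithin ℝ j f s x - iteratedFDerivWithin ℝ j f s y‖ ≤ B * ‖x - y‖ := by
  have hdiff : DifferentiableOn ℝ (iteratedFDerivWithin ℝ j f s) s :=
    hf.differentiableOn_iteratedFDerivWithin (by exact_mod_cast hj) hs
  refine ht.norm_image_sub_le_of_norm_hasFDerivWithin_le
    (fun z hz => (hdiff z (hts hz)).hasFDerivWithinAt.mono hts) (fun z hz => ?_) hy hx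
  rw [norm_fderivWithin_iteratedFDerivWithin]
  exact hB z hz

namespace HolderBoundOn

variable {k : ℕ} {α A B : ℝ} {f g : E → F} {s t : Set E}

theorem mono_set (hf : HolderBoundOn k α A f t) (hst : s ⊆ t) (hs : UniqueDiffOn ℝ s)
    (ht : UniqueDiffOn ℝ t) : HolderBoundOn k α A f s := by
  have heq : ∀ j ≤ k, ∀ x ∈ s, iteratedFDerivWithin ℝ j f s x = iteratedFDerivWithin ℝ j f t x :=
    fun j hj x hx => iteratedFDerivWithin_subset hst hs ht
      (hf.contDiffOn.of_le (by exact_mod_cast hj)) hx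
  refine ⟨hf.contDiffOn.mono hst, fun j hj x hx => ?_, fun x hx y hy => ?_⟩
  · rw [heq j hj x hx]
    exact hf.norm_le j hj x (hst hx)
  · rw [heq k le_rfl x hx, heq k le_rfl y hy]
    exact hf.holder_le x (hst hx) y (hst hy)

theorem sub (hf : HolderBoundOn k α A f s) (hg : HolderBoundOn k α B g s)
    (hs : UniqueDiffOn ℝ s) : HolderBoundOn k α (A + B) (f - g) s := by
  have heq : ∀ j ≤ k, ∀ x ∈ s, iteratedFDerivWithin ℝ j (f - g) s x =
      iteratedFDerivWithin ℝ j f s x - iteratedFDerivWithin ℝ j g s x := fun j hj x hx =>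
    iteratedFDerivWithin_sub_apply ((hf.contDiffOn x hx).of_le (by exact_mod_cast hj))
      ((hg.contDiffOn x hx).of_le (by exact_mod_cast hj)) hs hx
  refine ⟨hf.contDiffOn.sub hg.contDiffOn, fun j hj x hx => ?_, fun x hx y hy => ?_⟩
  · rw [heq j hj x hx]
    exact (norm_sub_le _ _).trans (add_le_add (hf.norm_le j hj x hx) (hg.norm_le j hj x hx))
  · rw [heq k le_rfl x hx, heq k le_rfl y hy, sub_sub_sub_comm, add_mul]
    exact (norm_sub_le _ _).trans
      (add_le_add (hf.holder_le x hx y hy) (hg.holder_le x hx y hy))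

theorem const_smul (hf : HolderBoundOn k α A f s) (hs : UniqueDiffOn ℝ s) (c : ℝ) :
    HolderBoundOn k α (|c| * A) (c • f) s := by
  have heq : ∀ j ≤ k, ∀ x ∈ s,
      iteratedFDerivWithin ℝ j (c • f) s x = c • iteratedFDerivWithin ℝ j f s x :=
    fun j hj x hx => iteratedFDerivWithin_const_smul_apply
      ((hf.contDiffOn x hx).of_le (by exact_mod_cast hj)) hs hx
  refine ⟨hf.contDiffOn.const_smul c, fun j hj x hx => ?_, fun x hx y hy => ?_⟩
  · rw [heq j hj x hx, norm_smul, Real.norm_eq_abs]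
    gcongr
    exact hf.norm_le j hj x hx
  · rw [heq k le_rfl x hx, heq k le_rfl y hy, ← smul_sub, norm_smul, Real.norm_eq_abs, mul_assoc]
    gcongr
    exact hf.holder_le x hx y hy

theorem tsum [CompleteSpace F] {ι : Type*} {A : ι → ℝ} {f : ι → E → F} (hA : Summable A)
    (hf : ∀ i, HolderBoundOn k α (A i) (f i) univ) :
    HolderBoundOn k α (∑' i, A i) (fun x => ∑' i, f i x) univ := by
  have hcont (i : ι) : ContDiff ℝ (k : ℕ∞) (f i) := contDiffOn_univ.1 (hf i).contDiffOn
  have hle (j : ℕ) (i : ι) (x : E) (hj : (j : ℕ∞) ≤ k) : ‖iteratedFDeriv ℝ j (f i) x‖ ≤ A i := by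
    rw [← iteratedFDerivWithin_univ]
    exact (hf i).norm_le j (by exact_mod_cast hj) x (mem_univ x)
  have htsum (j : ℕ) (hj : j ≤ k) (x : E) : iteratedFDeriv ℝ j (fun x => ∑' i, f i x) x =
      ∑' i, iteratedFDeriv ℝ j (f i) x :=
    iteratedFDeriv_tsum_apply hcont (fun _ _ => hA) hle (by exact_mod_cast hj) x
  have hsummable (x : E) : Summable fun i => iteratedFDeriv ℝ k (f i) x :=
    hA.of_norm_bounded fun i => hle k i x le_rfl
  refine ⟨contDiffOn_univ.2 (contDiff_tsum hcont (fun _ _ => hA) hle), fun j hj x _ => ?_,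
    fun x _ y _ => ?_⟩
  · rw [iteratedFDerivWithin_univ, htsum j hj]
    exact tsum_of_norm_bounded hA.hasSum fun i => hle j i x (by exact_mod_cast hj)
  · rw [iteratedFDerivWithin_univ, htsum k le_rfl, htsum k le_rfl,
      ← (hsummable x).tsum_sub (hsummable y)]
    refine tsum_of_norm_bounded (hA.hasSum.mul_right _) fun i => ?_
    simpa only [iteratedFDerivWithin_univ] using
      (hf i).holder_le x (mem_univ x) y (mem_univ y)

theorem of_norm_iteratedFDerivWithin_succ_le {R : ℝ} (hR : 1 ≤ R) (hα : α ∈ Icc (0 : ℝ) 1)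
    (hs : Convex ℝ s) (hs' : UniqueDiffOn ℝ s) (hf : ContDiffOn ℝ (k + 1 : ℕ) f s)
    (hA : ∀ j ≤ k, ∀ x ∈ s, ‖iteratedFDerivWithin ℝ j f s x‖ ≤ A)
    (hAR : ∀ x ∈ s, ‖iteratedFDerivWithin ℝ (k + 1) f s x‖ ≤ A * R) :
    HolderBoundOn k α (2 * A * R ^ α) f s := by
  have hA0 {x : E} (hx : x ∈ s) : 0 ≤ A := (norm_nonneg _).trans (hA 0 k.zero_le x hx)
  refine ⟨hf.of_le (by exact_mod_cast k.le_succ), fun j hj x hx => ?_, fun x hx y hy => ?_⟩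
  · nlinarith [hA j hj x hx, Real.one_le_rpow hR hα.1, hA0 hx]
  -- Interpolation between the bounds `2 * A` and `A * R * ‖x - y‖` of the difference.
  rw [mul_assoc, ← Real.mul_rpow (by linarith) (norm_nonneg _)]
  have hA0 := hA0 hx
  rcases le_total 1 (R * ‖x - y‖) with hfar | hnear
  · have hrpow : 1 ≤ (R * ‖x - y‖) ^ α := Real.one_le_rpow hfar hα.1
    calc _ ≤ A + A := (norm_sub_le _ _).trans (add_le_add (hA k le_rfl x hx) (hA k le_rfl y hy))
      _ ≤ 2 * A * (R * ‖x - y‖) ^ α := by nlinarith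
  · have hrpow : R * ‖x - y‖ ≤ (R * ‖x - y‖) ^ α := by
      simpa using Real.rpow_le_rpow_of_exponent_ge_of_imp (by positivity) hnear hα.2
        (fun _ h0 => absurd h0 one_ne_zero)
    calc _ ≤ A * R * ‖x - y‖ :=
          norm_iteratedFDerivWithin_sub_le hs' hf k.lt_succ_self subset_rfl hs hAR hx hy
      _ ≤ 2 * A * (R * ‖x - y‖) ^ α := by nlinarith [mul_nonneg hA0 (hrpow.trans' (by positivity))]

theorem norm_iteratedFDerivWithin_le_of_jet_le {p : E} {η δ : ℝ} (hf : HolderBoundOn k α A f s)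
    (hα : 0 ≤ α) (hs : Convex ℝ s) (hs' : UniqueDiffOn ℝ s) (hp : p ∈ s)
    (hjet : ∀ j ≤ k, ‖iteratedFDerivWithin ℝ j f s p‖ ≤ η) (hδ : 0 < δ) (hδ1 : δ ≤ 1) {i j : ℕ}
    (hij : j + i = k) {x : E} (hx : x ∈ s) (hxp : ‖x - p‖ ≤ δ) :
    ‖iteratedFDerivWithin ℝ j f s x‖ ≤ (i + 1) * η + A * δ ^ (i + α) := by
  have hA : 0 ≤ A := (norm_nonneg _).trans (hf.norm_le 0 k.zero_le p hp)
  have hη : 0 ≤ η := (norm_nonneg _).trans (hjet 0 k.zero_le)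
  have htriangle (j : ℕ) (x : E) := norm_le_norm_add_norm_sub'
    (iteratedFDerivWithin ℝ j f s x) (iteratedFDerivWithin ℝ j f s p)
  induction i generalizing j x with
  | zero =>
    obtain rfl : j = k := hij
    have hincr : A * ‖x - p‖ ^ α ≤ A * δ ^ α := by gcongr
    rw [Nat.cast_zero, zero_add, zero_add, one_mul]
    linarith [htriangle j x, hjet j le_rfl, hf.holder_le x hx p hp]
  | succ i ih =>
    let B := (i + 1) * η + A * δ ^ (i + α)
    have hincr : ‖iteratedFDerivWithin ℝ j f s x - iteratedFDerivWithin ℝ j f s p‖ ≤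
        B * ‖x - p‖ :=
      norm_iteratedFDerivWithin_sub_le hs' hf.contDiffOn (by omega : j < k)
        inter_subset_left (hs.inter (convex_closedBall p δ))
        (fun z hz => ih (by omega) hz.1 (mem_closedBall_iff_norm.1 hz.2))
        ⟨hx, mem_closedBall_iff_norm.2 hxp⟩ ⟨hp, Metric.mem_closedBall_self hδ.le⟩
    have hBδ : B * ‖x - p‖ ≤ (i + 1) * η + A * δ ^ (((i + 1 : ℕ) : ℝ) + α) := by
      have hpow : δ ^ (((i + 1 : ℕ) : ℝ) + α) = δ ^ (i + α) * δ := by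
        rw [← Real.rpow_add_one hδ.ne', Nat.cast_succ, add_right_comm]
      calc B * ‖x - p‖ ≤ B * δ := by gcongr
        _ = (i + 1) * η * δ + A * (δ ^ (i + α) * δ) := by ring
        _ ≤ (i + 1) * η + A * δ ^ (((i + 1 : ℕ) : ℝ) + α) := by
            rw [hpow]
            have := mul_le_of_le_one_right (by positivity : 0 ≤ (i + 1) * η) hδ1
            linarith
    push_cast at hBδ ⊢
    linarith [htriangle j x, hjet j (by omega)]

theorem norm_le_of_jet_le {p : E} {η δ : ℝ} (hf : HolderBoundOn k α A f s) (hα : 0 ≤ α)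
    (hs : Convex ℝ s) (hs' : UniqueDiffOn ℝ s) (hp : p ∈ s)
    (hjet : ∀ j ≤ k, ‖iteratedFDerivWithin ℝ j f s p‖ ≤ η) (hδ : 0 < δ) (hδ1 : δ ≤ 1) {x : E}
    (hx : x ∈ s) (hxp : ‖x - p‖ ≤ δ) : ‖f x‖ ≤ (k + 1) * η + A * δ ^ (k + α) := by
  rw [← norm_iteratedFDerivWithin_zero (𝕜 := ℝ) (f := f) (s := s)]
  exact hf.norm_iteratedFDerivWithin_le_of_jet_le hα hs hs' hp hjet hδ hδ1 (zero_add k) hx hxp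

end HolderBoundOn

end HolderBounds

/-! ### The cube and its grids -/

theorem convex_cube (d : ℕ) : Convex ℝ (cube d) :=
  fun _ hx _ hy _ _ ha hb hab i => convex_Icc (0 : ℝ) 1 (hx i) (hy i) ha hb hab

theorem uniqueDiffOn_cube (d : ℕ) : UniqueDiffOn ℝ (cube d) := by
  have hopen : IsOpen {x : EuclideanSpace ℝ (Fin d) | ∀ i, x i ∈ Ioo (0 : ℝ) 1} := by
    simp only [ofPred_forall]
    exact isOpen_iInter_of_finite fun i =>
      isOpen_Ioo.preimage (EuclideanSpace.proj (𝕜 := ℝ) i).continuous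
  have hcentre : WithLp.toLp 2 (fun _ => 1 / 2) ∈
      {x : EuclideanSpace ℝ (Fin d) | ∀ i, x i ∈ Ioo (0 : ℝ) 1} :=
    mem_ofPred.2 fun _ => by norm_num
  have hsub : {x : EuclideanSpace ℝ (Fin d) | ∀ i, x i ∈ Ioo (0 : ℝ) 1} ⊆ cube d :=
    fun _ hx i => Ioo_subset_Icc_self (mem_ofPred.1 hx i)
  exact uniqueDiffOn_convex (convex_cube d) ⟨_, interior_maximal hsub hopen hcentre⟩

theorem HolderBoundOn.mem_funSpace {d k : ℕ} {α : ℝ} {g : EuclideanSpace ℝ (Fin d) → ℝ}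
    (hg : HolderBoundOn k α 1 g (cube d)) :
    ⟨(cube d).domRestrict g, hg.contDiffOn.continuousOn.domRestrict⟩ ∈ funSpace d k α :=
  ⟨g, fun _ => rfl, hg.contDiffOn, hg.norm_le, fun _ x hx y hy => by
    simpa only [one_mul] using hg.holder_le x hx y hy⟩

theorem exists_holderBoundOn_of_mem_funSpace {d k : ℕ} {α : ℝ} (hα : 0 < α) {f : C(cube d, ℝ)}
    (hf : f ∈ funSpace d k α) :
    ∃ g : EuclideanSpace ℝ (Fin d) → ℝ, (∀ x : cube d, g x = f x) ∧
      HolderBoundOn k α 1 g (cube d) := by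
  obtain ⟨g, hgf, hcont, hle, hholder⟩ := hf
  exact ⟨g, hgf, hcont, hle, fun x hx y hy => by simpa only [one_mul] using hholder hα x hx y hy⟩

theorem funSpace_succ_zero_subset (d k : ℕ) : funSpace d (k + 1) 0 ⊆ funSpace d k 1 := by
  rintro f ⟨g, hgf, hcont, hle, -⟩
  refine ⟨g, hgf, hcont.of_le (by exact_mod_cast k.le_succ), fun j hj => hle j (hj.trans k.le_succ),
    fun _ x hx y hy => ?_⟩
  rw [Real.rpow_one, ← one_mul ‖x - y‖]
  exact norm_iteratedFDerivWithin_sub_le (uniqueDiffOn_cube d) hcont k.lt_succ_self subset_rfl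
    (convex_cube d) (hle (k + 1) le_rfl) hx hy

/-- The point `q / N` of the grid of mesh `1 / N`. -/
noncomputable def gridPoint {d M : ℕ} (N : ℕ) (q : Fin d → Fin M) : EuclideanSpace ℝ (Fin d) :=
  WithLp.toLp 2 fun i => (q i : ℝ) / N

theorem gridPoint_mem_cube {d M N : ℕ} (hMN : M ≤ N + 1) (q : Fin d → Fin M) :
    gridPoint N q ∈ cube d := by
  intro i
  have hq : ((q i : ℕ) : ℝ) ≤ N := by exact_mod_cast Nat.le_of_lt_succ ((q i).2.trans_le hMN)
  exact ⟨by simp only [gridPoint]; positivity, div_le_one_of_le₀ hq (by positivity)⟩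

/-! ### Sums of bumps -/

section DisjointSums

variable {E F ι : Type*} [NormedAddCommGroup E] [NormedAddCommGroup F] {C : ℝ}

theorem norm_sum_le_of_support_subsingleton {f : ι → F} {s : Finset ι} (hC : 0 ≤ C)
    (hf : ∀ i ∈ s, ‖f i‖ ≤ C) (hs : (s ∩ Function.support f : Set ι).Subsingleton) :
    ‖∑ i ∈ s, f i‖ ≤ C := by
  by_cases hzero : ∀ i ∈ s, f i = 0
  · rwa [Finset.sum_eq_zero hzero, norm_zero]
  push Not at hzero
  obtain ⟨i, hi, hfi⟩ := hzero
  rw [Finset.sum_eq_single_of_mem i hi fun j hj hji =>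
    by_contra fun hfj => hji (hs ⟨hj, hfj⟩ ⟨hi, hfi⟩)]
  exact hf i hi

variable [NormedSpace ℝ E] [NormedSpace ℝ F]

theorem norm_iteratedFDeriv_sum_le_of_disjoint {f : ι → E → F} {s : Finset ι} {j : ℕ} {x : E}
    (hf : ∀ i ∈ s, ContDiff ℝ j (f i)) (hC : 0 ≤ C)
    (hle : ∀ i ∈ s, ‖iteratedFDeriv ℝ j (f i) x‖ ≤ C)
    (hdisj : {i | x ∈ tsupport (f i)}.Subsingleton) :
    ‖iteratedFDeriv ℝ j (fun y => ∑ i ∈ s, f i y) x‖ ≤ C := by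
  rw [iteratedFDeriv_fun_sum_apply fun i hi => (hf i hi).contDiffAt]
  exact norm_sum_le_of_support_subsingleton hC hle <|
    hdisj.anti fun i hi => support_iteratedFDeriv_subset (𝕜 := ℝ) j hi.2

theorem norm_iteratedFDeriv_comp_smul_sub_le {f : E → F} {j : ℕ} (hf : ContDiff ℝ j f)
    (hC : ∀ x, ‖iteratedFDeriv ℝ j f x‖ ≤ C) (r : ℝ) (p x : E) :
    ‖iteratedFDeriv ℝ j (fun y => f (r • (y - p))) x‖ ≤ C * |r| ^ j := by
  rw [iteratedFDeriv_comp_sub j p (f := fun y => f (r • y)), iteratedFDeriv_comp_const_smul r hf,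
    norm_smul, norm_pow, Real.norm_eq_abs, mul_comm]
  gcongr
  exact hC _

theorem exists_norm_iteratedFDeriv_le_of_hasCompactSupport {f : E → F} {k : ℕ}
    (hf : ContDiff ℝ k f) (hsupp : HasCompactSupport f) :
    ∃ C > 0, ∀ j ≤ k, ∀ x, ‖iteratedFDeriv ℝ j f x‖ ≤ C := by
  have hbound (j : ℕ) : ∃ C, j ≤ k → ∀ x, ‖iteratedFDeriv ℝ j f x‖ ≤ C := by
    by_cases hj : j ≤ k
    · obtain ⟨C, hC⟩ := (hf.continuous_iteratedFDeriv (by exact_mod_cast hj :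
        (j : WithTop ℕ∞) ≤ k)).bounded_above_of_compact_support (hsupp.iteratedFDeriv j)
      exact ⟨C, fun _ => hC⟩
    · exact ⟨0, fun h => absurd h hj⟩
  choose C hC using hbound
  obtain ⟨B, hB⟩ := ((Finset.range (k + 1)).image C).exists_le
  refine ⟨max B 1, by positivity, fun j hj x => (hC j hj x).trans ((hB _ ?_).trans
    (le_max_left B 1))⟩
  exact Finset.mem_image_of_mem C (Finset.mem_range_succ_iff.2 hj)

end DisjointSums

/-- The model bump: it equals `1` at `0` and its integer translates have disjoint supports. -/
noncomputable def gridBump (d : ℕ) : ContDiffBump (0 : EuclideanSpace ℝ (Fin d)) :=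
  ⟨1 / 4, 1 / 3, by norm_num, by norm_num⟩

/-- The sum of the bumps of width `1 / N` centred at the points `q / N` of the grid with `q ∈ w`. -/
noncomputable def bumpSum {d N : ℕ} (w : Finset (Fin d → Fin N)) (x : EuclideanSpace ℝ (Fin d)) :
    ℝ :=
  ∑ q ∈ w, gridBump d ((N : ℝ) • (x - gridPoint N q))

section BumpSum

variable {d N : ℕ}

theorem contDiff_gridBump_comp {n : ℕ∞} (r : ℝ) (p : EuclideanSpace ℝ (Fin d)) :
    ContDiff ℝ n fun x => gridBump d (r • (x - p)) :=
  (gridBump d).contDiff.comp ((contDiff_id.sub contDiff_const).const_smul r)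

theorem subsingleton_setOf_mem_tsupport_gridBump (hN : 0 < N) (x : EuclideanSpace ℝ (Fin d)) :
    {q : Fin d → Fin N | (N : ℝ) • (x - gridPoint N q) ∈ tsupport (gridBump d)}.Subsingleton := by
  have hcoord {q : Fin d → Fin N} (hq : (N : ℝ) • (x - gridPoint N q) ∈ tsupport (gridBump d))
      (i : Fin d) : |N * x i - q i| ≤ 1 / 3 := by
    rw [ContDiffBump.tsupport_eq, mem_closedBall_zero_iff] at hq
    have hN' : (N : ℝ) ≠ 0 := by positivity
    have hi := (PiLp.norm_apply_le _ i).trans hq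
    rwa [PiLp.smul_apply, PiLp.sub_apply, gridPoint, smul_eq_mul, mul_sub, mul_div_cancel₀ _ hN',
      Real.norm_eq_abs] at hi
  intro q hq q' hq'
  funext i
  have hlow := abs_le.1 (hcoord hq i)
  have hupp := abs_le.1 (hcoord hq' i)
  have hlt : ((q i : ℕ) : ℝ) < (q' i : ℕ) + 1 := by linarith
  have hgt : ((q' i : ℕ) : ℝ) < (q i : ℕ) + 1 := by linarith
  norm_cast at hlt hgt
  exact Fin.ext (by omega)

theorem norm_iteratedFDeriv_bumpSum_le (hN : 0 < N) {j : ℕ} {C : ℝ}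
    (hC : ∀ x, ‖iteratedFDeriv ℝ j (gridBump d) x‖ ≤ C) (w : Finset (Fin d → Fin N))
    (x : EuclideanSpace ℝ (Fin d)) :
    ‖iteratedFDeriv ℝ j (bumpSum w) x‖ ≤ C * (N : ℝ) ^ j := by
  have hC0 : 0 ≤ C := (norm_nonneg _).trans (hC 0)
  refine norm_iteratedFDeriv_sum_le_of_disjoint (fun q _ => contDiff_gridBump_comp _ _)
    (by positivity) (fun q _ => ?_) ?_
  · simpa only [Nat.abs_cast] using
      norm_iteratedFDeriv_comp_smul_sub_le (gridBump d).contDiff hC N (gridPoint N q) x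
  · refine (subsingleton_setOf_mem_tsupport_gridBump hN x).anti fun q hq => ?_
    exact tsupport_comp_subset_preimage (gridBump d)
      ((continuous_id.sub continuous_const).const_smul (N : ℝ)) hq

theorem bumpSum_mem_Icc (hN : 0 < N) (w : Finset (Fin d → Fin N))
    (x : EuclideanSpace ℝ (Fin d)) : bumpSum w x ∈ Icc (0 : ℝ) 1 := by
  refine ⟨Finset.sum_nonneg fun q _ => (gridBump d).nonneg, (Real.le_norm_self _).trans ?_⟩
  have hle (y) : ‖iteratedFDeriv ℝ 0 (gridBump d) y‖ ≤ 1 := by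
    rw [norm_iteratedFDeriv_zero, Real.norm_of_nonneg (gridBump d).nonneg]
    exact (gridBump d).le_one
  simpa using norm_iteratedFDeriv_bumpSum_le hN hle w x

theorem bumpSum_gridPoint (hN : 0 < N) (w : Finset (Fin d → Fin N)) (q : Fin d → Fin N) :
    bumpSum w (gridPoint N q) = if q ∈ w then 1 else 0 := by
  have hone : gridBump d 0 = 1 :=
    (gridBump d).one_of_mem_closedBall (Metric.mem_closedBall_self (gridBump d).rIn_pos.le)
  have hself : (N : ℝ) • (gridPoint N q - gridPoint N q) ∈ tsupport (gridBump d) := by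
    rw [sub_self, smul_zero]
    exact subset_tsupport _ (by rw [Function.mem_support, hone]; exact one_ne_zero)
  have hzero : ∀ q' ∈ w, q' ≠ q → gridBump d ((N : ℝ) • (gridPoint N q - gridPoint N q')) = 0 :=
    fun q' _ hne => by_contra fun h => hne <|
      subsingleton_setOf_mem_tsupport_gridBump hN _ (subset_tsupport _ h) hself
  split_ifs with hq
  · rw [bumpSum, Finset.sum_eq_single_of_mem q hq hzero, sub_self, smul_zero, hone]
  · exact Finset.sum_eq_zero fun q' hq' => hzero q' hq' fun h => hq (h ▸ hq')

theorem exists_holderBoundOn_bumpSum (d k : ℕ) {α : ℝ} (hα : α ∈ Icc (0 : ℝ) 1) :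
    ∃ C > 0, ∀ N > 0, ∀ w : Finset (Fin d → Fin N),
      HolderBoundOn k α (C * (N : ℝ) ^ (k + α)) (bumpSum w) univ := by
  obtain ⟨C, hC0, hC⟩ := exists_norm_iteratedFDeriv_le_of_hasCompactSupport
    (gridBump d).contDiff (gridBump d).hasCompactSupport (k := k + 1)
  refine ⟨2 * C, by positivity, fun N hN w => ?_⟩
  have hN1 : (1 : ℝ) ≤ N := by exact_mod_cast hN
  have hsmooth : ContDiff ℝ (k + 1 : ℕ) (bumpSum w) :=
    ContDiff.sum fun q _ => contDiff_gridBump_comp _ _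
  have hconst : 2 * C * (N : ℝ) ^ (k + α) = 2 * (C * (N : ℝ) ^ k) * (N : ℝ) ^ α := by
    rw [Real.rpow_add (by linarith), Real.rpow_natCast]
    ring
  rw [hconst]
  refine .of_norm_iteratedFDerivWithin_succ_le hN1 hα convex_univ uniqueDiffOn_univ
    hsmooth.contDiffOn (fun j hj x _ => ?_) (fun x _ => ?_) <;> rw [iteratedFDerivWithin_univ]
  · exact (norm_iteratedFDeriv_bumpSum_le hN (hC j (by omega)) w x).trans (by gcongr)
  · rw [mul_assoc, ← pow_succ]
    exact norm_iteratedFDeriv_bumpSum_le hN (hC (k + 1) le_rfl) w x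

end BumpSum

/-! ### The lower bound -/

theorem half_norm_le_norm_tsum {F : Type*} [NormedAddCommGroup F] [CompleteSpace F] {f : ℕ → F}
    {n : ℕ} {θ : ℝ} (hθ : 0 ≤ θ) (hθ3 : θ ≤ 1 / 3) (hzero : ∀ m < n, f m = 0)
    (hle : ∀ m, ‖f (n + m)‖ ≤ ‖f n‖ * θ ^ m) : ‖f n‖ / 2 ≤ ‖∑' m, f m‖ := by
  have hgeo : HasSum (fun m => ‖f n‖ * θ ^ m) (‖f n‖ * (1 - θ)⁻¹) :=
    (hasSum_geometric_of_lt_one hθ (by linarith)).mul_left _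
  have hsummable : Summable f := (summable_nat_add_iff n).1 <|
    hgeo.summable.of_norm_bounded fun m => add_comm n m ▸ hle m
  have hhead : ∑ m ∈ Finset.range (n + 1), f m = f n := by
    rw [Finset.sum_range_succ, Finset.sum_eq_zero fun m hm => hzero m (Finset.mem_range.1 hm),
      zero_add]
  have htail : ‖∑' m, f (m + (n + 1))‖ ≤ ‖f n‖ * (1 - θ)⁻¹ * θ :=
    tsum_of_norm_bounded (hgeo.mul_right θ) fun m => by
      simpa only [mul_assoc, ← pow_succ, add_assoc, add_comm, add_left_comm] using hle (m + 1)
  have hratio : (1 - θ)⁻¹ * θ ≤ 1 / 2 := by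
    rw [inv_mul_le_iff₀ (by linarith)]
    linarith
  have htriangle := norm_sub_le_norm_add (f n) (∑' m, f (m + (n + 1)))
  rw [← hsummable.sum_add_tsum_nat_add (n + 1), hhead]
  nlinarith [norm_nonneg (f n)]

/-- The superposition over all `n` of the bumps of width `b ^ (-n)` and height `c * θ ^ n` centred
at the points of the grid of mesh `b ^ (-n)` which are selected by `σ n`. -/
noncomputable def bumpSeries {d b : ℕ} (c θ : ℝ) (σ : ∀ n : ℕ, Finset (Fin d → Fin (b ^ n)))
    (x : EuclideanSpace ℝ (Fin d)) : ℝ :=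
  ∑' n, c * θ ^ n * bumpSum (σ n) x

section BumpSeries

variable {d b : ℕ} {c θ : ℝ}

theorem pow_mul_rpow_eq (θ s : ℝ) (b n : ℕ) :
    θ ^ n * ((b ^ n : ℕ) : ℝ) ^ s = (θ * (b : ℝ) ^ s) ^ n := by
  rw [mul_pow, Nat.cast_pow, Real.rpow_pow_comm b.cast_nonneg]

theorem exists_holderBoundOn_bumpSeries (d k : ℕ) {α : ℝ} (hα : α ∈ Icc (0 : ℝ) 1) (hb : 0 < b)
    (hθ : 0 ≤ θ) (hθb : θ * (b : ℝ) ^ (k + α) < 1) :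
    ∃ c > 0, ∀ σ : ∀ n : ℕ, Finset (Fin d → Fin (b ^ n)),
      HolderBoundOn k α 1 (bumpSeries c θ σ) univ := by
  obtain ⟨C, hC0, hC⟩ := exists_holderBoundOn_bumpSum d k hα
  let ρ := θ * (b : ℝ) ^ (k + α)
  have hρ : 0 < 1 - ρ := sub_pos.2 hθb
  have hgeo : HasSum (fun n => (1 - ρ) * ρ ^ n) 1 := by
    have h := (hasSum_geometric_of_lt_one (by positivity : 0 ≤ ρ) hθb).mul_left (1 - ρ)
    rwa [mul_inv_cancel₀ hρ.ne'] at h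
  refine ⟨(1 - ρ) / C, div_pos hρ hC0, fun σ => ?_⟩
  have hterm (n : ℕ) : HolderBoundOn k α ((1 - ρ) * ρ ^ n)
      (fun x => (1 - ρ) / C * θ ^ n * bumpSum (σ n) x) univ := by
    have hconst : |(1 - ρ) / C * θ ^ n| * (C * ((b ^ n : ℕ) : ℝ) ^ (k + α)) =
        (1 - ρ) * ρ ^ n := by
      rw [abs_of_nonneg (by positivity), ← pow_mul_rpow_eq]
      field_simp
    rw [← hconst]
    exact (hC (b ^ n) (pow_pos hb n) (σ n)).const_smul uniqueDiffOn_univ _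
  have hsum := HolderBoundOn.tsum hgeo.summable hterm
  rwa [hgeo.tsum_eq] at hsum

theorem summable_mul_bumpSum (hb : 0 < b) (c : ℝ) (hθ : θ ∈ Ico (0 : ℝ) 1)
    (σ : ∀ n : ℕ, Finset (Fin d → Fin (b ^ n))) (x : EuclideanSpace ℝ (Fin d)) :
    Summable fun n => c * θ ^ n * bumpSum (σ n) x := by
  refine ((summable_geometric_of_lt_one hθ.1 hθ.2).mul_left |c|).of_norm_bounded fun n => ?_
  obtain ⟨h0, h1⟩ := bumpSum_mem_Icc (pow_pos hb n) (σ n) x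
  rw [norm_mul, norm_mul, norm_pow, Real.norm_of_nonneg h0, Real.norm_of_nonneg hθ.1]
  exact mul_le_of_le_one_right (mul_nonneg (abs_nonneg c) (pow_nonneg hθ.1 n)) h1

theorem exists_le_dist_bumpSeries (hb : 0 < b) (hc : 0 ≤ c) (hθ : 0 ≤ θ) (hθ3 : θ ≤ 1 / 3)
    {σ τ : ∀ n : ℕ, Finset (Fin d → Fin (b ^ n))} {n : ℕ} (hne : σ n ≠ τ n) :
    ∃ x ∈ cube d, c / 2 * θ ^ n ≤ dist (bumpSeries c θ σ x) (bumpSeries c θ τ x) := by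
  classical
  have hex : ∃ m, σ m ≠ τ m := ⟨n, hne⟩
  set m := Nat.find hex
  obtain ⟨q, hq⟩ : ∃ q, ¬ (q ∈ σ m ↔ q ∈ τ m) := by
    simpa only [Finset.ext_iff, not_forall, ne_eq] using Nat.find_spec hex
  refine ⟨gridPoint (b ^ m) q, gridPoint_mem_cube (Nat.le_succ _) q, ?_⟩
  set x := gridPoint (b ^ m) q with hx
  let f (i : ℕ) : ℝ := c * θ ^ i * (bumpSum (σ i) x - bumpSum (τ i) x)
  have hsum : bumpSeries c θ σ x - bumpSeries c θ τ x = ∑' i, f i := by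
    have hθI : θ ∈ Ico (0 : ℝ) 1 := ⟨hθ, by linarith⟩
    simp only [f, mul_sub]
    exact ((summable_mul_bumpSum hb c hθI σ x).tsum_sub
      (summable_mul_bumpSum hb c hθI τ x)).symm
  have hfm : ‖f m‖ = c * θ ^ m := by
    have hdiff : ‖bumpSum (σ m) x - bumpSum (τ m) x‖ = 1 := by
      rw [hx, bumpSum_gridPoint (pow_pos hb m), bumpSum_gridPoint (pow_pos hb m)]
      by_cases hσ : q ∈ σ m <;> by_cases hτ : q ∈ τ m <;> simp_all
    rw [norm_mul, hdiff, mul_one, Real.norm_of_nonneg (by positivity)]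
  have hzero : ∀ i < m, f i = 0 := fun i hi => by
    simp only [f, not_not.1 (Nat.find_min hex hi), sub_self, mul_zero]
  have hle (i : ℕ) : ‖f (m + i)‖ ≤ ‖f m‖ * θ ^ i := by
    rw [hfm, mul_assoc, ← pow_add, norm_mul, Real.norm_of_nonneg (by positivity)]
    refine mul_le_of_le_one_right (by positivity) ?_
    simpa [Real.dist_eq] using Real.dist_le_of_mem_Icc
      (bumpSum_mem_Icc (pow_pos hb _) (σ (m + i)) x) (bumpSum_mem_Icc (pow_pos hb _) (τ (m + i)) x)
  have hpow : θ ^ n ≤ θ ^ m :=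
    pow_le_pow_of_le_one hθ (by linarith) (Nat.find_min' hex hne)
  calc c / 2 * θ ^ n ≤ c / 2 * θ ^ m := by gcongr
    _ = ‖f m‖ / 2 := by rw [hfm]; ring
    _ ≤ _ := by
      rw [dist_eq_norm, hsum]
      exact half_norm_le_norm_tsum hθ hθ3 hzero hle

end BumpSeries

theorem hausdorffMeas_ord_funSpace {d k : ℕ} {α β : ℝ} (hα : α ∈ Icc (0 : ℝ) 1) (hβ : 0 < β)
    (hβd : β * (k + α) < d) : hausdorffMeas (ord β) (funSpace d k α) = ⊤ := by
  have hkα : 0 ≤ k + α := add_nonneg k.cast_nonneg hα.1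
  have hd : 0 < d := by exact_mod_cast (mul_nonneg hβ.le hkα).trans_lt hβd
  obtain ⟨t, hst, htβ⟩ := exists_between ((lt_div_iff₀' hβ).2 hβd)
  rw [lt_div_iff₀' hβ] at htβ
  have ht : 0 < t := hkα.trans_lt hst
  obtain ⟨b, hb2, hbt⟩ : ∃ b : ℕ, 2 ≤ b ∧ (3 : ℝ) ≤ (b : ℝ) ^ t :=
    ((eventually_ge_atTop 2).and (((tendsto_rpow_atTop ht).comp
      tendsto_natCast_atTop_atTop).eventually_ge_atTop 3)).exists
  have hb1 : (1 : ℝ) < b := by exact_mod_cast hb2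
  have hb0 : (0 : ℝ) < b := by linarith
  let θ : ℝ := (b : ℝ) ^ (-t)
  have hθ0 : 0 < θ := Real.rpow_pos_of_pos hb0 _
  have hθ3 : θ ≤ 1 / 3 := by
    simp only [θ, Real.rpow_neg hb0.le, one_div]
    exact inv_anti₀ (by norm_num) hbt
  have hθb : θ * (b : ℝ) ^ (k + α) < 1 := by
    rw [← Real.rpow_add hb0]
    exact Real.rpow_lt_one_of_one_lt_of_neg hb1 (by linarith)
  have hθβ : θ ^ (-β) < (b : ℝ) ^ d := by
    rw [← Real.rpow_mul hb0.le, ← Real.rpow_natCast]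
    exact Real.rpow_lt_rpow_of_exponent_lt hb1 (by linarith)
  obtain ⟨c, hc, hΦ⟩ := exists_holderBoundOn_bumpSeries d k hα (by omega : 0 < b) hθ0.le hθb
  let Φ (σ : ∀ n, Finset (Fin d → Fin (b ^ n))) : funSpace d k α :=
    ⟨_, ((hΦ σ).mono_set (subset_univ _) (uniqueDiffOn_cube d) uniqueDiffOn_univ).mem_funSpace⟩
  refine hausdorffMeas_ord_eq_top_of_separated Φ hβ.le (half_pos hc) ⟨hθ0, by linarith⟩
    (one_lt_pow₀ hb1 hd.ne') hθβ (Real.log_pos one_lt_two) (fun n => le_of_eq ?_)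
    fun σ τ n hne => ?_
  · rw [Fintype.card_finset, Fintype.card_fun, Fintype.card_fin, Fintype.card_fin, mul_comm,
      ← pow_mul, mul_comm d, pow_mul, ← Nat.cast_pow, ← Nat.cast_pow, Real.exp_nat_mul,
      Real.exp_log two_pos, Nat.cast_pow, Nat.cast_ofNat]
  · obtain ⟨x, hx, hle⟩ := exists_le_dist_bumpSeries (by omega) hc.le hθ0.le hθ3 hne
    exact hle.trans ((Φ σ).1.dist_apply_le_dist (g := (Φ τ).1) ⟨x, hx⟩)

theorem le_hausdorffScale_funSpace (d k : ℕ) {α : ℝ} (hα : α ∈ Icc (0 : ℝ) 1) :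
    (d : ℝ≥0∞) / ((k : ℝ≥0∞) + ENNReal.ofReal α) ≤ hausdorffScale ord (funSpace d k α) := by
  refine ENNReal.le_of_forall_nnreal_lt fun β hβ => ?_
  rcases eq_zero_or_pos β with rfl | hβ0
  · exact zero_le
  have hlt : (β : ℝ≥0∞) * (k + ENNReal.ofReal α) < d :=
    (ENNReal.lt_div_iff_mul_lt (.inr ENNReal.coe_ne_top)
      (.inl (ENNReal.add_ne_top.2 ⟨ENNReal.natCast_ne_top k, ENNReal.ofReal_ne_top⟩))).1 hβ
  have hlt' : (β : ℝ) * (k + α) < d := by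
    simpa [ENNReal.toReal_add, ENNReal.toReal_ofReal hα.1] using
      ENNReal.toReal_strict_mono (ENNReal.natCast_ne_top d) hlt
  rw [← ENNReal.ofReal_coe_nnreal]
  exact le_iSup₂_of_le (β : ℝ) ⟨hβ0, hausdorffMeas_ord_funSpace hα hβ0 hlt'⟩ le_rfl

/-! ### The upper bound -/

theorem norm_multilinear_le_of_orthonormalBasis {ι κ 𝕜 E F : Type*} [RCLike 𝕜] [Fintype ι]
    [Fintype κ] [NormedAddCommGroup E] [InnerProductSpace 𝕜 E] [SeminormedAddCommGroup F]
    [NormedSpace 𝕜 F] (e : OrthonormalBasis κ 𝕜 E)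
    (T : ContinuousMultilinearMap 𝕜 (fun _ : ι => E) F) {η : ℝ} (hη : 0 ≤ η)
    (hT : ∀ r : ι → κ, ‖T fun i => e (r i)‖ ≤ η) :
    ‖T‖ ≤ (Fintype.card κ : ℝ) ^ Fintype.card ι * η := by
  classical
  refine T.opNorm_le_bound (by positivity) fun m => ?_
  have hterm (r : ι → κ) : ‖T fun i => e.repr (m i) (r i) • e (r i)‖ ≤ η * ∏ i, ‖m i‖ := by
    rw [T.map_smul_univ, norm_smul, norm_prod, mul_comm]
    gcongr with i
    · exact hT r
    · exact (PiLp.norm_apply_le _ _).trans_eq (e.repr.norm_map (m i))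
  calc ‖T m‖ = ‖∑ r : ι → κ, T fun i => e.repr (m i) (r i) • e (r i)‖ := by
        rw [← T.map_sum fun i l => e.repr (m i) l • e l]
        simp only [e.sum_repr]
    _ ≤ ∑ _r : ι → κ, η * ∏ i, ‖m i‖ := norm_sum_le_of_le _ fun r _ => hterm r
    _ = (Fintype.card κ : ℝ) ^ Fintype.card ι * η * ∏ i, ‖m i‖ := by
        rw [Finset.sum_const, Finset.card_univ, Fintype.card_fun, nsmul_eq_mul, Nat.cast_pow,
          mul_assoc]

theorem exists_norm_sub_gridPoint_le {d N : ℕ} (hN : 0 < N) {x : EuclideanSpace ℝ (Fin d)}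
    (hx : x ∈ cube d) : ∃ q : Fin d → Fin (N + 1), ‖x - gridPoint N q‖ ≤ d / N := by
  have hN' : (0 : ℝ) < N := by exact_mod_cast hN
  have hfloor (i : Fin d) : ⌊N * x i⌋₊ < N + 1 := Nat.lt_succ_of_le <|
    Nat.floor_le_of_le (mul_le_of_le_one_right hN'.le (hx i).2)
  let q (i : Fin d) : Fin (N + 1) := ⟨⌊N * x i⌋₊, hfloor i⟩
  have hcoord (i : Fin d) : |(x - gridPoint N q) i| ≤ 1 / N := by
    have hlow := Nat.floor_le (mul_nonneg hN'.le (hx i).1)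
    have hupp := Nat.lt_floor_add_one (N * x i)
    have heq : (x - gridPoint N q) i = (N * x i - ⌊N * x i⌋₊) / N := by
      rw [PiLp.sub_apply, gridPoint, sub_div, mul_div_cancel_left₀ _ hN'.ne']
    rw [heq, abs_div, abs_of_pos hN', abs_of_nonneg (by linarith)]
    gcongr
    linarith
  refine ⟨q, ?_⟩
  let e := EuclideanSpace.basisFun (Fin d) ℝ
  calc ‖x - gridPoint N q‖ = ‖∑ i, e.repr (x - gridPoint N q) i • e i‖ := by rw [e.sum_repr]
    _ ≤ ∑ _i : Fin d, 1 / (N : ℝ) := norm_sum_le_of_le _ fun i _ => by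
        rw [norm_smul, e.norm_eq_one, mul_one]
        exact hcoord i
    _ = d / N := by
        rw [Finset.sum_const, Finset.card_univ, Fintype.card_fin, nsmul_eq_mul, mul_one_div]

/-- The partial derivatives of order at most `k` of `g` at the points of the grid of mesh `1 / N` of
the cube. A partial derivative of order `j` is encoded by the sequence of the `j` indices of the
variables. -/
noncomputable def jetOnGrid {d : ℕ} (k N : ℕ) (g : EuclideanSpace ℝ (Fin d) → ℝ)
    (qr : (Fin d → Fin (N + 1)) × Σ j : Fin (k + 1), Fin j → Fin d) : ℝ :=
  iteratedFDerivWithin ℝ qr.2.1 g (cube d) (gridPoint N qr.1)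
    fun i => EuclideanSpace.basisFun (Fin d) ℝ (qr.2.2 i)

section JetOnGrid

variable {d k N : ℕ} {α A : ℝ} {f g : EuclideanSpace ℝ (Fin d) → ℝ}

theorem abs_jetOnGrid_le (hg : HolderBoundOn k α A g (cube d))
    (qr : (Fin d → Fin (N + 1)) × Σ j : Fin (k + 1), Fin j → Fin d) : |jetOnGrid k N g qr| ≤ A := by
  refine ((iteratedFDerivWithin ℝ qr.2.1 g (cube d)
    (gridPoint N qr.1)).le_opNorm _).trans ?_
  simp only [OrthonormalBasis.norm_eq_one, Finset.prod_const_one, mul_one]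
  exact hg.norm_le _ (Nat.le_of_lt_succ qr.2.1.2) _ (gridPoint_mem_cube le_rfl qr.1)

theorem jetOnGrid_sub (hf : ContDiffOn ℝ k f (cube d)) (hg : ContDiffOn ℝ k g (cube d))
    (qr : (Fin d → Fin (N + 1)) × Σ j : Fin (k + 1), Fin j → Fin d) :
    jetOnGrid k N (f - g) qr = jetOnGrid k N f qr - jetOnGrid k N g qr := by
  have hp : gridPoint N qr.1 ∈ cube d := gridPoint_mem_cube le_rfl qr.1
  have hj : ((qr.2.1 : ℕ) : WithTop ℕ∞) ≤ k := by exact_mod_cast Nat.le_of_lt_succ qr.2.1.2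
  rw [jetOnGrid, iteratedFDerivWithin_sub_apply ((hf _ hp).of_le hj) ((hg _ hp).of_le hj)
    (uniqueDiffOn_cube d) hp]
  rfl

theorem norm_le_of_abs_jetOnGrid_le {η : ℝ} (hg : HolderBoundOn k α A g (cube d)) (hα : 0 ≤ α)
    (hd : 0 < d) (hN : d ≤ N) (hjet : ∀ qr, |jetOnGrid k N g qr| ≤ η)
    {x : EuclideanSpace ℝ (Fin d)} (hx : x ∈ cube d) :
    ‖g x‖ ≤ (k + 1) * ((d : ℝ) ^ k * η) + A * ((d : ℝ) / N) ^ (k + α) := by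
  have hd1 : (1 : ℝ) ≤ d := by exact_mod_cast hd
  have hN0 : 0 < N := hd.trans_le hN
  obtain ⟨q, hq⟩ := exists_norm_sub_gridPoint_le hN0 hx
  have hη : 0 ≤ η := (abs_nonneg _).trans (hjet (q, ⟨0, Fin.elim0⟩))
  refine hg.norm_le_of_jet_le hα (convex_cube d) (uniqueDiffOn_cube d)
    (gridPoint_mem_cube le_rfl q) (fun j hj => ?_) (by positivity)
    (div_le_one_of_le₀ (by exact_mod_cast hN) (by positivity)) hx hq
  have hnorm := norm_multilinear_le_of_orthonormalBasis (EuclideanSpace.basisFun (Fin d) ℝ)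
    (iteratedFDerivWithin ℝ j g (cube d) (gridPoint N q)) hη
    fun r => hjet (q, ⟨⟨j, Nat.lt_succ_of_le hj⟩, r⟩)
  rw [Fintype.card_fin, Fintype.card_fin] at hnorm
  exact hnorm.trans (by gcongr)

theorem coveringNumber_subset_funSpace_le (hd : 0 < d) (hα : 0 < α) {S : Set C(cube d, ℝ)}
    (hS : S ⊆ funSpace d k α) {M : ℕ} (hM : 0 < M) (hN : d ≤ N) {ε : ℝ}
    (hε : (k + 1) * ((d : ℝ) ^ k / M) + 2 * ((d : ℝ) / N) ^ (k + α) < ε) :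
    coveringNumber S ε ≤
      ((2 * M + 1) ^ ((N + 1) ^ d * Fintype.card (Σ j : Fin (k + 1), Fin j → Fin d)) : ℕ) := by
  choose g hgf hg using fun f : S => exists_holderBoundOn_of_mem_funSpace hα (hS f.2)
  have hcover := coveringNumber_le_pow_of_coordinates (X := S) (ε := ε) hM
    (fun f => jetOnGrid k N (g f)) (fun f => abs_jetOnGrid_le (hg f)) fun f f' hff' => ?_
  · rwa [Fintype.card_prod, Fintype.card_fun, Fintype.card_fin, Fintype.card_fin] at hcover
  refine lt_of_le_of_lt ?_ hε
  rw [Subtype.dist_eq, ContinuousMap.dist_le (by positivity)]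
  intro x
  have hsub := (hg f).sub (hg f') (uniqueDiffOn_cube d)
  have hle := norm_le_of_abs_jetOnGrid_le (N := N) hsub hα.le hd hN (fun qr => by
    rw [jetOnGrid_sub (hg f).contDiffOn (hg f').contDiffOn]
    exact hff' qr) x.2
  rwa [Pi.sub_apply, hgf, hgf, ← dist_eq_norm, one_add_one_eq_two, ← div_eq_mul_inv] at hle

theorem coveringNumber_subset_funSpace_le_pow_ceil (hd : 0 < d) (hα : 0 < α)
    {S : Set C(cube d, ℝ)} (hS : S ⊆ funSpace d k α) {y ε : ℝ} (hy : 0 < y)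
    (hdy : d ≤ y ^ (1 / (k + α))) (hε : ((k + 1) * (d : ℝ) ^ k + 2 * (d : ℝ) ^ (k + α)) / y < ε) :
    coveringNumber S ε ≤ ((2 * ⌈y⌉₊ + 1) ^ ((⌈y ^ (1 / (k + α))⌉₊ + 1) ^ d *
      Fintype.card (Σ j : Fin (k + 1), Fin j → Fin d)) : ℕ) := by
  have hceil : y ^ (1 / (k + α)) ≤ ⌈y ^ (1 / (k + α))⌉₊ := Nat.le_ceil _
  refine coveringNumber_subset_funSpace_le hd hα hS (Nat.ceil_pos.2 hy)
    (by exact_mod_cast hdy.trans hceil) (lt_of_le_of_lt ?_ hε)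
  have hpow : y ≤ (⌈y ^ (1 / (k + α))⌉₊ : ℝ) ^ (k + α) := by
    have h := Real.rpow_le_rpow (by positivity) hceil (by positivity : 0 ≤ k + α)
    rwa [← Real.rpow_mul hy.le, one_div_mul_cancel (by positivity), Real.rpow_one] at h
  calc _ ≤ (k + 1) * ((d : ℝ) ^ k / y) + 2 * ((d : ℝ) ^ (k + α) / y) := by
        rw [Real.div_rpow d.cast_nonneg (Nat.cast_nonneg _)]
        gcongr
        exact Nat.le_ceil y
    _ = _ := by ring

end JetOnGrid

theorem tendsto_mul_rpow_neg_sub_rpow_neg (c : ℝ) {γ β : ℝ} (hβ : 0 < β) (hγβ : γ < β) :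
    Tendsto (fun ε : ℝ => c * ε ^ (-γ) - ε ^ (-β)) (𝓝[>] 0) atBot := by
  have hsmall : Tendsto (fun ε : ℝ => c * ε ^ (β - γ) - 1) (𝓝[>] 0) (𝓝 (c * 0 - 1)) := by
    have h := (Real.continuousAt_rpow_const 0 (β - γ) (.inr (sub_pos.2 hγβ).le)).tendsto
    rw [Real.zero_rpow (sub_pos.2 hγβ).ne'] at h
    exact ((h.mono_left nhdsWithin_le_nhds).const_mul c).sub_const 1
  have hlarge : Tendsto (fun ε : ℝ => ε ^ (-β)) (𝓝[>] 0) atTop :=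
    tendsto_rpow_neg_nhdsGT_zero (neg_neg_of_pos hβ)
  refine (hlarge.atTop_mul_neg (by norm_num) hsmall).congr' ?_
  filter_upwards [self_mem_nhdsWithin] with ε hε
  rw [mul_sub, mul_one, mul_left_comm, ← Real.rpow_add hε, neg_add_eq_sub, sub_sub_cancel_left]

theorem upperBoxScale_ord_le_of_coveringNumber_le {X : Type*} [PseudoMetricSpace X] {c γ : ℝ}
    (hγ : 0 ≤ γ)
    (hX : ∀ᶠ ε in 𝓝[>] 0, (coveringNumber X ε : ℝ≥0∞) ≤ ENNReal.ofReal (Real.exp (c * ε ^ (-γ)))) :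
    upperBoxScale ord X ≤ ENNReal.ofReal γ := by
  have hlim : Tendsto ENNReal.ofReal (𝓝[>] γ) (𝓝 (ENNReal.ofReal γ)) :=
    ENNReal.continuous_ofReal.continuousWithinAt
  refine ge_of_tendsto hlim (eventually_mem_nhdsWithin.mono fun β hγβ => ?_)
  have hβ : 0 < β := hγ.trans_lt hγβ
  have hzero : Tendsto (fun ε => ENNReal.ofReal (Real.exp (c * ε ^ (-γ) - ε ^ (-β)))) (𝓝[>] 0)
      (𝓝 0) := by
    rw [← ENNReal.ofReal_zero]
    exact ENNReal.tendsto_ofReal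
      (Real.tendsto_exp_atBot.comp (tendsto_mul_rpow_neg_sub_rpow_neg c hβ hγβ))
  refine iInf₂_le β ⟨hβ, tendsto_of_tendsto_of_tendsto_of_le_of_le' tendsto_const_nhds hzero
    (.of_forall fun _ => zero_le) (hX.mono fun ε hε => ?_)⟩
  rw [sub_eq_add_neg, Real.exp_add, ENNReal.ofReal_mul (Real.exp_pos _).le]
  exact mul_le_mul_left hε _

theorem pow_ceil_le_exp (d L : ℕ) {s κ y : ℝ} (hs : 0 < s) (hκ : 0 < κ) (hy : 1 ≤ y) :
    (2 * (⌈y⌉₊ : ℝ) + 1) ^ ((⌈y ^ (1 / s)⌉₊ + 1) ^ d * L) ≤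
      Real.exp (3 ^ d * L * (5 ^ κ / κ) * y ^ (d / s + κ)) := by
  have hy0 : 0 < y := by linarith
  have hM : 2 * (⌈y⌉₊ : ℝ) + 1 ≤ 5 * y := by linarith [Nat.ceil_lt_add_one hy0.le]
  have hN : (⌈y ^ (1 / s)⌉₊ : ℝ) + 1 ≤ 3 * y ^ (1 / s) := by
    have hone : 1 ≤ y ^ (1 / s) := Real.one_le_rpow hy (by positivity)
    linarith [Nat.ceil_lt_add_one (zero_le_one.trans hone)]
  have hlog : Real.log (2 * (⌈y⌉₊ : ℝ) + 1) ≤ (5 * y) ^ κ / κ :=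
    (Real.log_le_log (by positivity) hM).trans (Real.log_le_rpow_div (by positivity) hκ)
  rw [← Real.log_le_iff_le_exp (by positivity), Real.log_pow]
  push_cast
  calc ((⌈y ^ (1 / s)⌉₊ : ℝ) + 1) ^ d * L * Real.log (2 * ⌈y⌉₊ + 1)
      ≤ (3 * y ^ (1 / s)) ^ d * L * ((5 * y) ^ κ / κ) := by
        gcongr
        exact Real.log_nonneg (by linarith [(Nat.cast_nonneg ⌈y⌉₊ : (0 : ℝ) ≤ _)])
    _ = 3 ^ d * L * (5 ^ κ / κ) * y ^ (d / s + κ) := by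
        rw [mul_pow, ← Real.rpow_mul_natCast hy0.le, Real.mul_rpow (by norm_num) hy0.le,
          Real.rpow_add hy0, one_div_mul_eq_div]
        ring

theorem upperBoxScale_subset_funSpace_le_add {d k : ℕ} (hd : 0 < d) {α κ : ℝ} (hα : 0 < α)
    (hκ : 0 < κ) {S : Set C(cube d, ℝ)} (hS : S ⊆ funSpace d k α) :
    upperBoxScale ord S ≤ ENNReal.ofReal (d / (k + α) + κ) := by
  let B : ℝ := (k + 1) * (d : ℝ) ^ k + 2 * (d : ℝ) ^ (k + α)
  let L := Fintype.card (Σ j : Fin (k + 1), Fin j → Fin d)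
  let γ := d / (k + α) + κ
  have hB : 0 < B := by positivity
  have hy : Tendsto (fun ε : ℝ => 2 * B / ε) (𝓝[>] 0) atTop :=
    tendsto_inv_nhdsGT_zero.const_mul_atTop (by positivity)
  refine upperBoxScale_ord_le_of_coveringNumber_le
    (c := 3 ^ d * L * (5 ^ κ / κ) * (2 * B) ^ γ) (by positivity) ?_
  filter_upwards [self_mem_nhdsWithin, hy.eventually_ge_atTop 1,
    ((tendsto_rpow_atTop (by positivity : 0 < 1 / (k + α))).comp hy).eventually_ge_atTop (d : ℝ)]
    with ε (hε : 0 < ε) h1y hdy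
  have hlt : B / (2 * B / ε) < ε := by
    rw [div_div_eq_mul_div, div_lt_iff₀ (by positivity)]
    linarith [mul_pos hB hε]
  have hcover : (coveringNumber S ε : ℝ≥0∞) ≤ _ := ENat.toENNReal_le.2 <|
    coveringNumber_subset_funSpace_le_pow_ceil hd hα hS (by positivity) hdy hlt
  have hexp := pow_ceil_le_exp d L (by positivity : 0 < k + α) hκ h1y
  have hpow : (2 * B / ε) ^ γ = (2 * B) ^ γ * ε ^ (-γ) := by
    rw [Real.div_rpow (by positivity) hε.le, Real.rpow_neg hε.le, div_eq_mul_inv]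
  rw [hpow, ← mul_assoc] at hexp
  refine hcover.trans (le_trans ?_ (ENNReal.ofReal_le_ofReal hexp))
  rw [ENat.toENNReal_coe, ← ENNReal.ofReal_natCast]
  push_cast
  exact le_rfl

theorem upperBoxScale_subset_funSpace_le {d k : ℕ} (hd : 0 < d) {α : ℝ} (hα : 0 < α)
    {S : Set C(cube d, ℝ)} (hS : S ⊆ funSpace d k α) :
    upperBoxScale ord S ≤ (d : ℝ≥0∞) / ((k : ℝ≥0∞) + ENNReal.ofReal α) := by
  have hlim : Tendsto (fun κ => ENNReal.ofReal (d / (k + α) + κ)) (𝓝[>] 0)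
      (𝓝 (ENNReal.ofReal (d / (k + α) + 0))) :=
    (ENNReal.continuous_ofReal.comp (continuous_const.add continuous_id)).continuousWithinAt
  have hle := ge_of_tendsto hlim (eventually_mem_nhdsWithin.mono fun κ hκ =>
    upperBoxScale_subset_funSpace_le_add hd hα hκ hS)
  rwa [add_zero, ENNReal.ofReal_div_of_pos (by positivity),
    ENNReal.ofReal_add (by positivity) hα.le, ENNReal.ofReal_natCast,
    ENNReal.ofReal_natCast] at hle

theorem upperBoxScale_funSpace_le {d : ℕ} (hd : 0 < d) (k : ℕ) {α : ℝ} (hα : 0 ≤ α) :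
    upperBoxScale ord (funSpace d k α) ≤ (d : ℝ≥0∞) / ((k : ℝ≥0∞) + ENNReal.ofReal α) := by
  rcases hα.lt_or_eq with hα | rfl
  · exact upperBoxScale_subset_funSpace_le hd hα subset_rfl
  rcases k with _ | k
  · rw [Nat.cast_zero, ENNReal.ofReal_zero, add_zero,
      ENNReal.div_zero (by exact_mod_cast hd.ne' : (d : ℝ≥0∞) ≠ 0)]
    exact le_top
  · simpa using upperBoxScale_subset_funSpace_le hd one_pos (funSpace_succ_zero_subset d k)

end MetricScale

theorem mainTheorem7 (d : ℕ) (hd : 0 < d) (k : ℕ) (α : ℝ) (hα : α ∈ Set.Icc (0 : ℝ) 1) :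
    MetricScale.hausdorffScale MetricScale.ord (MetricScale.funSpace d k α) =
        (d : ℝ≥0∞) / ((k : ℝ≥0∞) + ENNReal.ofReal α) ∧
    MetricScale.packingScale MetricScale.ord (MetricScale.funSpace d k α) =
        (d : ℝ≥0∞) / ((k : ℝ≥0∞) + ENNReal.ofReal α) ∧
    MetricScale.lowerBoxScale MetricScale.ord (MetricScale.funSpace d k α) =
        (d : ℝ≥0∞) / ((k : ℝ≥0∞) + ENNReal.ofReal α) ∧
    MetricScale.upperBoxScale MetricScale.ord (MetricScale.funSpace d k α) =
        (d : ℝ≥0∞) / ((k : ℝ≥0∞) + ENNReal.ofReal α) := by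
  have hH := MetricScale.le_hausdorffScale_funSpace d k hα
  have hU := MetricScale.upperBoxScale_funSpace_le hd k hα.1
  have hHP := MetricScale.isScaling_ord.hausdorffScale_le_packingScale
    (X := MetricScale.funSpace d k α)
  have hPU := MetricScale.packingScale_le_upperBoxScale (scl := MetricScale.ord)
    (X := MetricScale.funSpace d k α)
  have hHL := MetricScale.isScaling_ord.hausdorffScale_le_lowerBoxScale
    (X := MetricScale.funSpace d k α)
  have hLU := MetricScale.isScaling_ord.lowerBoxScale_le_upperBoxScale
    (X := MetricScale.funSpace d k α)
  exact ⟨le_antisymm ((hHP.trans hPU).trans hU) hH, le_antisymm (hPU.trans hU) (hH.trans hHP),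
    le_antisymm (hLU.trans hU) (hH.trans hHL), le_antisymm hU (hH.trans (hHL.trans hLU))⟩
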